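/- **Setting.** Let $d\ge 1$ and let $\mathbb B^d$ be the open unit ball of $\mathbb C^d$. All Hilbert spaces are complex and separable (possibly finite-dimensional). For $z\in\mathbb B^d$ and a Hilbert space $\mathcal H$, let $z^*:\mathcal H\to\mathcal H\otimes\mathbb C^d$, $z^*h=(\bar z_1h,\dots,\bar z_dh)$, with adjoint $z(h_1,\dots,h_d)=\sum_j z_jh_j$, and write $zw^*=\sum_j z_j\bar w_j$. For a contraction $A$ put $D_A=\sqrt{I-A^*A}$; $A$ is *pure* if $\|Ah\|<\|h\|$ for all $h\ne0$. $\bigvee$ is closed linear span. *Multipliers.* $H^2_d\otimes\mathcal J$ is the $\mathcal J$-valued reproducing kernel Hilbert space on $\mathbb B^d$ with kernel $(1-zw^*)^{-1}I$. The Schur class $\mathscr S_d(\mathcal J,\mathcal K)$ is the set of $b:\mathbb B^d\to\mathscr L(\mathcal J,\mathcal K)$ such that $f\mapsto bf$ is a contraction from $H^2_d\otimes\mathcal J$ into $H^2_d\otimes\mathcal K$; $b$ is *purely contractive* if every $b(z)$ is pure. $\mathscr H(b)$ is the $\mathcal K$-valued reproducing kernel Hilbert space with kernel $k^b(z,w)=(1-zw^*)^{-1}(I-b(z)b(w)^*)$,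 and $k^b_0:\mathcal K\to\mathscr H(b)$ is the adjoint of $f\mapsto f(0)$. *Gleason solutions.* A contractive Gleason solution for $\mathscr H(b)$ is a bounded operator $X=(X_1,\dots,X_d):\mathscr H(b)\otimes\mathbb C^d\to\mathscr H(b)$ with $\sum_j z_j(X_j^*f)(z)=f(z)-f(0)$ for all $f\in\mathscr H(b)$, $z\in\mathbb B^d$, and $XX^*\le I-k_0^b(k_0^b)^*$; it is extremal if equality holds. A contractive Gleason solution for $b$ is a bounded operator $\mathbf b=(b_1,\dots,b_d)^T:\mathcal J\to\mathscr H(b)\otimes\mathbb C^d$ with $b(z)h-b(0)h=\sum_j z_j(b_jh)(z)$ for all $h\in\mathcal J$, $z\in\mathbb B^d$, and $\mathbf b^*\mathbf b\le I-b(0)^*b(0)$; it is extremal if equality holds. A purely contractive $b\in\mathscr S_d(\mathcal J,\mathcal K)$ is *quasi-extreme* if $b$ has a unique contractive Gleason solution and this solution is extremal. *Weak coincidence.* Let $\mathrm{supp}(b)=\bigvee_{z}\mathrm{ran}\,b(z)^*$. Functions $b_1,b_2$ *coincide* if $Rb_1(z)=b_2(z)Q$ for all $z$, with fixed unitaries $R,Q$;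 they *coincide weakly* if $b_1|_{\mathrm{supp}(b_1)}$ and $b_2|_{\mathrm{supp}(b_2)}$ coincide. *Row contractions.* A row contraction is a contraction $T:\mathcal H\otimes\mathbb C^d\to\mathcal H$. It is *CCNC* if $\mathcal H=\bigvee_{z\in\mathbb B^d}(I-Tz^*)^{-1}\mathrm{ran}\,D_{T^*}$. Two row contractions are unitarily equivalent ($T_1\simeq T_2$) if $UT_1=T_2(U\otimes I_d)$ for some unitary $U:\mathcal H_1\to\mathcal H_2$. *Characteristic functions.* Let $T$ be a CCNC row contraction and $V=TP_{\ker D_T}$ its partial isometric part. A model triple $(\gamma,\mathcal J_\infty,\mathcal J_0)$ for $V$ consists of Hilbert spaces $\mathcal J_\infty,\mathcal J_0$, linear isomorphisms $\gamma(z):\mathcal J_0\to\big(\mathrm{ran}\,(V-z)V^*V\big)^\perp$ for $z\in\mathbb B^d$, with $\gamma(0)$ isometric, and an onto isometry $\gamma(\infty):\mathcal J_\infty\to\ker V$. Put $$b_V^\gamma(z)=\big(\gamma(z)^*\gamma(0)\big)^{-1}z\,(\gamma(z)^*\otimes I_d)\gamma(\infty),\qquad \delta=-\gamma(0)^*T\gamma(\infty),$$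 $$b_T^\gamma(z)=D_{\delta^*}^{-1}\big(b_V^\gamma(z)+\delta\big)\big(I+\delta^*b_V^\gamma(z)\big)^{-1}D_\delta .$$ A *characteristic function* of $T$ is any Schur class function $b$ that coincides weakly with $b_T^\gamma$ for some model triple. $T$ is *QE* if it is a CCNC row contraction and has a quasi-extreme characteristic function. **Theorem.** 1. If $b$ is quasi-extreme, then $\mathscr H(b)$ has a unique contractive Gleason solution $X^b$, and $X^b$ is extremal. A row contraction $T$ is QE if and only if $T\simeq X^b$ for some purely contractive, quasi-extreme Schur multiplier $b\in\mathscr S_d(\mathcal J,\mathcal K)$ and some $\mathcal J,\mathcal K$. 2. If $T$ is QE and $b_T$ is any characteristic function of $T$, then $\mathscr H(b_T)$ has a unique contractive Gleason solution $X^{b_T}$, it is extremal, and $T\simeq X^{b_T}$. 3. If $T_1,T_2$ are QE with characteristic functions $b_{T_1},b_{T_2}$, then $T_1\simeq T_2$ if and only if $b_{T_1}$ and $b_{T_2}$ coincide weakly. -/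

import Mathlib

open scoped InnerProduct ComplexConjugate

universe u

noncomputable section

namespace RowModel

/-! ### The unit ball, row operators, defect operators -/

/-- The open unit ball of `ℂ^d`. -/
abbrev UnitBall (d : ℕ) : Type := ↥(Metric.ball (0 : EuclideanSpace ℂ (Fin d)) 1)

/-- The centre of the ball. -/
def origin (d : ℕ) : UnitBall d := ⟨0, Metric.mem_ball_self one_pos⟩

/-- `H ⊗ ℂ^d`, as the Hilbert space direct sum of `d` copies of `H`. -/
abbrev Copies (d : ℕ) (H : Type*) : Type _ := PiLp 2 (fun _ : Fin d => H)

section Operators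

variable {d : ℕ} {H : Type*} [NormedAddCommGroup H] [InnerProductSpace ℂ H]
variable {H' : Type*} [NormedAddCommGroup H'] [InnerProductSpace ℂ H']

/-- `z^* : H → H ⊗ ℂ^d`, `h ↦ (conj z₁ h, …, conj z_d h)`. -/
def colStar (H : Type*) [NormedAddCommGroup H] [InnerProductSpace ℂ H]
    (z : UnitBall d) : H →L[ℂ] Copies d H :=
  (PiLp.continuousLinearEquiv 2 ℂ (fun _ : Fin d => H)).symm.toContinuousLinearMap ∘L
    ContinuousLinearMap.pi (fun j => conj (z.1 j) • ContinuousLinearMap.id ℂ H)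

/-- `A ⊗ I_d : H ⊗ ℂ^d → H' ⊗ ℂ^d`. -/
def ampl (d : ℕ) (A : H →L[ℂ] H') : Copies d H →L[ℂ] Copies d H' :=
  (PiLp.continuousLinearEquiv 2 ℂ (fun _ : Fin d => H')).symm.toContinuousLinearMap ∘L
    ContinuousLinearMap.piMap (fun _ => A) ∘L
      (PiLp.continuousLinearEquiv 2 ℂ (fun _ : Fin d => H)).toContinuousLinearMap

@[simp] theorem colStar_apply (z : UnitBall d) (h : H) (j : Fin d) :
    colStar H z h j = conj (z.1 j) • h := rfl

@[simp] theorem ampl_apply (A : H →L[ℂ] H') (x : Copies d H) (j : Fin d) :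
    ampl d A x j = A (x j) := rfl

variable [CompleteSpace H] [CompleteSpace H']

/-- `z = (z^*)^* : H ⊗ ℂ^d → H`. -/
def rowMul (H : Type*) [NormedAddCommGroup H] [InnerProductSpace ℂ H] [CompleteSpace H]
    (z : UnitBall d) : Copies d H →L[ℂ] H := (colStar H z)†

/-- The defect operator `D_T = √(I - T^* T)` of a contraction `T`. -/
def defect (T : H →L[ℂ] H') : H →L[ℂ] H := CFC.sqrt (1 - T† ∘L T)

/-- The resolvent `(I - T z^*)⁻¹`. -/
def resolvent (T : Copies d H →L[ℂ] H) (z : UnitBall d) : H →L[ℂ] H :=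
  Ring.inverse (1 - T ∘L colStar H z)

/-- Pure contraction: `‖T h‖ < ‖h‖` for all `h ≠ 0`. -/
def IsPure (T : H →L[ℂ] H') : Prop := ∀ h : H, h ≠ 0 → ‖T h‖ < ‖h‖

/-- Row contractions `T = (T₁, …, T_d) : H ⊗ ℂ^d → H`. -/
def IsRowContraction (T : Copies d H →L[ℂ] H) : Prop := ‖T‖ ≤ 1

/-- The commutative CNC condition: the closed span of the ranges of
`(I - T z^*)⁻¹ D_{T^*}`, `z` in the ball, is everything. -/
def IsCCNC (T : Copies d H →L[ℂ] H) : Prop :=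
  (⨆ z : UnitBall d, LinearMap.range (resolvent T z ∘L defect (T†)).toLinearMap).topologicalClosure
    = ⊤

/-- Unitary equivalence of row operators: `U T₁ = T₂ (U ⊗ I_d)` for a unitary `U`. -/
def UnitarilyEquivalent (T₁ : Copies d H →L[ℂ] H) (T₂ : Copies d H' →L[ℂ] H') : Prop :=
  ∃ U : H ≃ₗᵢ[ℂ] H', ∀ x : Copies d H,
    U (T₁ x) = T₂ (ampl d (U.toContinuousLinearEquiv : H →L[ℂ] H') x)

/-- The partial isometric part `V = T P_{ker D_T}` of a row contraction `T = V - C`. -/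
def isometricPart (T : Copies d H →L[ℂ] H) : Copies d H →L[ℂ] H :=
  T ∘L (LinearMap.ker (defect T).toLinearMap).starProjection

/-- The restricted range space `ran ((V - z) V^* V)`. -/
def restrictedRange (V : Copies d H →L[ℂ] H) (z : UnitBall d) : Submodule ℂ H :=
  LinearMap.range ((V - rowMul H z) ∘L V† ∘L V).toLinearMap

end Operators

/-! ### Model triples and characteristic functions -/

section Model

variable {d : ℕ} {H : Type*} [NormedAddCommGroup H] [InnerProductSpace ℂ H] [CompleteSpace H]

/-- A model triple `(γ, J∞, J₀)` for a row partial isometry `V`: `γ(z)` is a linear isomorphism of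
`J₀` onto `ran ((V - z) V^* V)^⊥`, and `γ(0)`, `γ(∞) : J∞ → ker V` are onto isometries. -/
structure ModelTriple (V : Copies d H →L[ℂ] H)
    (Jinf : Type*) [NormedAddCommGroup Jinf] [InnerProductSpace ℂ Jinf]
    (J₀ : Type*) [NormedAddCommGroup J₀] [InnerProductSpace ℂ J₀] where
  atPoint : (z : UnitBall d) → J₀ ≃L[ℂ] ((restrictedRange V z)ᗮ : Submodule ℂ H)
  atInfinity : Jinf ≃ₗᵢ[ℂ] LinearMap.ker V.toLinearMap
  norm_atOrigin : ∀ h : J₀, ‖atPoint (origin d) h‖ = ‖h‖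

namespace ModelTriple

variable {V : Copies d H →L[ℂ] H}
variable {Jinf : Type*} [NormedAddCommGroup Jinf] [InnerProductSpace ℂ Jinf] [CompleteSpace Jinf]
variable {J₀ : Type*} [NormedAddCommGroup J₀] [InnerProductSpace ℂ J₀] [CompleteSpace J₀]

/-- `γ(z)` as an operator into `H`. -/
def map (γ : ModelTriple V Jinf J₀) (z : UnitBall d) : J₀ →L[ℂ] H :=
  ((restrictedRange V z)ᗮ).subtypeL ∘L (γ.atPoint z : J₀ →L[ℂ] ((restrictedRange V z)ᗮ : _))

/-- `γ(∞)` as an operator into `H ⊗ ℂ^d`. -/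
def mapInf (γ : ModelTriple V Jinf J₀) : Jinf →L[ℂ] Copies d H :=
  (LinearMap.ker V.toLinearMap).subtypeL ∘L
    (γ.atInfinity.toContinuousLinearEquiv : Jinf →L[ℂ] LinearMap.ker V.toLinearMap)

/-- `D(z) = γ(z)^* γ(0)`. -/
def denom (γ : ModelTriple V Jinf J₀) (z : UnitBall d) : J₀ →L[ℂ] J₀ :=
  (γ.map z)† ∘L γ.map (origin d)

/-- `N(z) = (γ(z)^* ⊗ I_d) γ(∞)`. -/
def numer (γ : ModelTriple V Jinf J₀) (z : UnitBall d) : Jinf →L[ℂ] Copies d J₀ :=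
  ampl d ((γ.map z)†) ∘L γ.mapInf

/-- The characteristic function `b_V(z) = D(z)⁻¹ z N(z)` of the row partial isometry `V`. -/
def charFun (γ : ModelTriple V Jinf J₀) (z : UnitBall d) : Jinf →L[ℂ] J₀ :=
  Ring.inverse (γ.denom z) ∘L rowMul J₀ z ∘L γ.numer z

/-- The zero-point contraction `δ_T = - γ(0)^* T γ(∞)`. -/
def zeroPoint (γ : ModelTriple V Jinf J₀) (T : Copies d H →L[ℂ] H) : Jinf →L[ℂ] J₀ :=
  -((γ.map (origin d))† ∘L T ∘L γ.mapInf)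

end ModelTriple

end Model

section Coincidence

variable {d : ℕ}
variable {J : Type*} [NormedAddCommGroup J] [InnerProductSpace ℂ J] [CompleteSpace J]
variable {K : Type*} [NormedAddCommGroup K] [InnerProductSpace ℂ K] [CompleteSpace K]
variable {J' : Type*} [NormedAddCommGroup J'] [InnerProductSpace ℂ J'] [CompleteSpace J']
variable {K' : Type*} [NormedAddCommGroup K'] [InnerProductSpace ℂ K'] [CompleteSpace K']

/-- `b` is `z ↦ D_{δ^*}⁻¹ (b₀(z) + δ) (I + δ^* b₀(z))⁻¹ D_δ`, the `δ`-Frostman shift of a function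
`b₀` with `b₀(0) = 0`.  For a pure contraction `δ` the operator `D_{δ^*}` is injective with a
possibly unbounded inverse, so `b(z) = D_{δ^*}⁻¹ A` is written as `D_{δ^*} b(z) = A`. -/
def IsFrostmanShift (δ : J →L[ℂ] K) (b₀ b : UnitBall d → J →L[ℂ] K) : Prop :=
  ∀ z, defect (δ†) ∘L b z = (b₀ z + δ) ∘L Ring.inverse (1 + δ† ∘L b₀ z) ∘L defect δ

/-- The support: the closed span of the ranges of `b(z)^*`. -/
def supp (b : UnitBall d → J →L[ℂ] K) : Submodule ℂ J :=
  (⨆ z, LinearMap.range ((b z)†).toLinearMap).topologicalClosure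

/-- Coincidence: `R b₁(z) = b₂(z) Q` for fixed unitaries `R`, `Q`. -/
def Coincide (b₁ : UnitBall d → J →L[ℂ] K) (b₂ : UnitBall d → J' →L[ℂ] K') : Prop :=
  ∃ (R : K ≃ₗᵢ[ℂ] K') (Q : J ≃ₗᵢ[ℂ] J'), ∀ z h, R (b₁ z h) = b₂ z (Q h)

/-- Weak coincidence: the restrictions to the supports coincide. -/
def WeaklyCoincide (b₁ : UnitBall d → J →L[ℂ] K) (b₂ : UnitBall d → J' →L[ℂ] K') : Prop :=
  Coincide (fun z => b₁ z ∘L (supp b₁).subtypeL) (fun z => b₂ z ∘L (supp b₂).subtypeL)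

end Coincidence

/-! ### Drury–Arveson space, the Schur class, de Branges–Rovnyak spaces -/

section Spaces

/-- The Szegő kernel `(1 - z w^*)⁻¹ I`, where `z w^* = ∑ z_j conj w_j`. -/
def szegoKernel (d : ℕ) (J : Type*) [NormedAddCommGroup J] [InnerProductSpace ℂ J] :
    Matrix (UnitBall d) (UnitBall d) (J →L[ℂ] J) :=
  .of fun z w => (1 - inner ℂ w.1 z.1)⁻¹ • (1 : J →L[ℂ] J)

theorem norm_inner_lt_one {d : ℕ} (z w : UnitBall d) : ‖inner ℂ w.1 z.1‖ < 1 := by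
  have hz : ‖z.1‖ < 1 := mem_ball_zero_iff.mp z.2
  have hw : ‖w.1‖ < 1 := mem_ball_zero_iff.mp w.2
  calc ‖inner ℂ w.1 z.1‖ ≤ ‖w.1‖ * ‖z.1‖ := norm_inner_le_norm _ _
    _ < 1 := mul_lt_one_of_nonneg_of_lt_one_left (norm_nonneg _) hw hz.le

variable {d : ℕ}
variable {J : Type*} [NormedAddCommGroup J] [InnerProductSpace ℂ J]
variable {K : Type*} [NormedAddCommGroup K] [InnerProductSpace ℂ K]

theorem inner_szegoKernel (x x' : UnitBall d) (w w' : J) :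
    inner ℂ (szegoKernel d J x' x w) w' = (1 - inner ℂ x'.1 x.1)⁻¹ * inner ℂ w w' := by
  simp [szegoKernel, mul_comm]

theorem sum_pow_inner_nonneg (vv : UnitBall d →₀ J) (n : ℕ) :
    0 ≤ RCLike.re (∑ x ∈ vv.support, ∑ x' ∈ vv.support,
      (inner ℂ x'.1 x.1) ^ n * inner ℂ (vv x) (vv x')) := by
  have key : (∑ x ∈ vv.support, ∑ x' ∈ vv.support,
      (inner ℂ x'.1 x.1) ^ n * inner ℂ (vv x) (vv x')) =
      ∑ p : Fin n → Fin d,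
        inner ℂ (∑ x ∈ vv.support, conj (∏ i, x.1 (p i)) • vv x)
          (∑ x ∈ vv.support, conj (∏ i, x.1 (p i)) • vv x) := by
    have h1 : ∀ p : Fin n → Fin d,
        inner ℂ (∑ x ∈ vv.support, conj (∏ i, x.1 (p i)) • vv x)
          (∑ x ∈ vv.support, conj (∏ i, x.1 (p i)) • vv x) =
        ∑ x ∈ vv.support, ∑ x' ∈ vv.support,
          (∏ i, x.1 (p i) * conj (x'.1 (p i))) * inner ℂ (vv x) (vv x') := by
      intro p
      rw [sum_inner]
      refine Finset.sum_congr rfl fun x _ => ?_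
      rw [inner_sum]
      refine Finset.sum_congr rfl fun x' _ => ?_
      rw [inner_smul_left, inner_smul_right, RCLike.conj_conj, Finset.prod_mul_distrib, map_prod]
      ring
    rw [Fintype.sum_congr _ _ h1]
    conv_rhs => rw [Finset.sum_comm]
    refine Finset.sum_congr rfl fun x _ => ?_
    conv_rhs => rw [Finset.sum_comm]
    refine Finset.sum_congr rfl fun x' _ => ?_
    rw [PiLp.inner_apply, Fintype.sum_pow, Finset.sum_mul]
    refine Finset.sum_congr rfl fun p _ => ?_
    simp only [RCLike.inner_apply]
  rw [key, map_sum]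
  exact Finset.sum_nonneg fun p _ => inner_self_nonneg

open scoped ComplexOrder in
instance szegoKernel_posSemidef [CompleteSpace J] : Fact (szegoKernel d J).PosSemidef := by
  have e := (RKHS.posSemidef_tfae (K := szegoKernel d J)).out 0 2
  refine ⟨e.mpr ⟨?_, fun vv => ?_⟩⟩
  · ext z w : 1
    refine ContinuousLinearMap.ext fun v => ext_inner_right ℂ fun u => ?_
    simp [szegoKernel, inner_smul_left]
  · simp only [Finsupp.sum, inner_szegoKernel]
    have hs : HasSum (fun n : ℕ => ∑ x ∈ vv.support, ∑ x' ∈ vv.support,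
        (inner ℂ x'.1 x.1) ^ n * inner ℂ (vv x) (vv x'))
        (∑ x ∈ vv.support, ∑ x' ∈ vv.support,
          (1 - inner ℂ x'.1 x.1)⁻¹ * inner ℂ (vv x) (vv x')) :=
      hasSum_sum fun x _ => hasSum_sum fun x' _ =>
        (hasSum_geometric_of_norm_lt_one (norm_inner_lt_one x x')).mul_right _
    exact (RCLike.hasSum_re ℂ hs).nonneg fun n => sum_pow_inner_nonneg vv n

/-- The vector-valued Drury–Arveson space `H²_d ⊗ J`. -/
def DruryArveson (d : ℕ) (J : Type*) [NormedAddCommGroup J] [InnerProductSpace ℂ J]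
    [CompleteSpace J] : Type _ := RKHS.OfKernel (szegoKernel d J)

variable [CompleteSpace J] [CompleteSpace K]

instance : NormedAddCommGroup (DruryArveson d J) :=
  inferInstanceAs (NormedAddCommGroup (RKHS.OfKernel (szegoKernel d J)))
instance : InnerProductSpace ℂ (DruryArveson d J) :=
  inferInstanceAs (InnerProductSpace ℂ (RKHS.OfKernel (szegoKernel d J)))
instance : CompleteSpace (DruryArveson d J) :=
  inferInstanceAs (CompleteSpace (RKHS.OfKernel (szegoKernel d J)))
instance : RKHS ℂ (DruryArveson d J) (UnitBall d) J :=
  inferInstanceAs (RKHS ℂ (RKHS.OfKernel (szegoKernel d J)) (UnitBall d) J)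

theorem kernel_druryArveson : RKHS.kernel (DruryArveson d J) = szegoKernel d J :=
  RKHS.OfKernel.kernel_ofKernel

/-- The Schur class `𝒮_d(J, K)`: multipliers of `H²_d ⊗ J` into `H²_d ⊗ K` of norm at most one. -/
structure SchurClass (d : ℕ)
    (J : Type*) [NormedAddCommGroup J] [InnerProductSpace ℂ J] [CompleteSpace J]
    (K : Type*) [NormedAddCommGroup K] [InnerProductSpace ℂ K] [CompleteSpace K] where
  toFun : UnitBall d → J →L[ℂ] K
  contractive_multiplier : ∀ f : DruryArveson d J, ∃ g : DruryArveson d K,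
    (∀ z, g z = toFun z (f z)) ∧ ‖g‖ ≤ ‖f‖

instance : CoeFun (SchurClass d J K) (fun _ => UnitBall d → J →L[ℂ] K) := ⟨SchurClass.toFun⟩

/-- The de Branges–Rovnyak kernel `(I - b(z) b(w)^*) / (1 - z w^*)`. -/
def dbrKernel (b : SchurClass d J K) : Matrix (UnitBall d) (UnitBall d) (K →L[ℂ] K) :=
  .of fun z w => (1 - inner ℂ w.1 z.1)⁻¹ • (1 - b z ∘L (b w)†)

theorem norm_sum_kerFun_le (b : SchurClass d J K) (vv : UnitBall d →₀ K) :
    ‖∑ x ∈ vv.support, RKHS.kerFun (DruryArveson d J) x (((b x)†) (vv x))‖ ≤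
      ‖∑ x ∈ vv.support, RKHS.kerFun (DruryArveson d K) x (vv x)‖ := by
  set f := ∑ x ∈ vv.support, RKHS.kerFun (DruryArveson d J) x (((b x)†) (vv x)) with hf
  set h := ∑ x ∈ vv.support, RKHS.kerFun (DruryArveson d K) x (vv x) with hh
  obtain ⟨g, hg, hgf⟩ := b.contractive_multiplier f
  have h1 : inner ℂ f f = inner ℂ h g := by
    conv_lhs => enter [2]; rw [hf]
    rw [hh, sum_inner, sum_inner]
    refine Finset.sum_congr rfl fun x _ => ?_
    rw [RKHS.kerFun_inner, RKHS.kerFun_inner, ContinuousLinearMap.adjoint_inner_left, hg]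
  have h2 : ‖f‖ * ‖f‖ ≤ ‖h‖ * ‖f‖ := by
    calc ‖f‖ * ‖f‖ = ‖inner ℂ f f‖ := by
          rw [inner_self_eq_norm_sq_to_K]; simp [sq]
      _ ≤ ‖h‖ * ‖g‖ := by rw [h1]; exact norm_inner_le_norm _ _
      _ ≤ ‖h‖ * ‖f‖ := by gcongr
  rcases (norm_nonneg f).eq_or_lt with h0 | h0
  · rw [← h0]; exact norm_nonneg _
  · exact le_of_mul_le_mul_right h2 h0

theorem inner_dbrKernel (b : SchurClass d J K) (x x' : UnitBall d) (w w' : K) :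
    inner ℂ (dbrKernel b x' x w) w' =
      inner ℂ (RKHS.kerFun (DruryArveson d K) x w) (RKHS.kerFun (DruryArveson d K) x' w') -
      inner ℂ (RKHS.kerFun (DruryArveson d J) x (((b x)†) w))
        (RKHS.kerFun (DruryArveson d J) x' (((b x')†) w')) := by
  rw [← RKHS.kernel_inner, ← RKHS.kernel_inner, kernel_druryArveson, kernel_druryArveson,
    inner_szegoKernel, inner_szegoKernel, ContinuousLinearMap.adjoint_inner_right]
  simp [dbrKernel]
  ring

open scoped ComplexOrder in
instance dbrKernel_posSemidef (b : SchurClass d J K) : Fact (dbrKernel b).PosSemidef := by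
  have e := (RKHS.posSemidef_tfae (K := dbrKernel b)).out 0 2
  refine ⟨e.mpr ⟨?_, fun vv => ?_⟩⟩
  · ext z w : 1
    refine ContinuousLinearMap.ext fun v => ext_inner_right ℂ fun u => ?_
    simp [dbrKernel, ContinuousLinearMap.star_eq_adjoint, inner_smul_left, inner_sub_left]
  · have key : (vv.sum fun x w => vv.sum fun x' w' => inner ℂ (dbrKernel b x' x w) w') =
        inner ℂ (∑ x ∈ vv.support, RKHS.kerFun (DruryArveson d K) x (vv x))
          (∑ x ∈ vv.support, RKHS.kerFun (DruryArveson d K) x (vv x)) -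
        inner ℂ (∑ x ∈ vv.support, RKHS.kerFun (DruryArveson d J) x (((b x)†) (vv x)))
          (∑ x ∈ vv.support, RKHS.kerFun (DruryArveson d J) x (((b x)†) (vv x))) := by
      simp only [Finsupp.sum, inner_dbrKernel, Finset.sum_sub_distrib, sum_inner]
      simp only [inner_sum]
    rw [key, map_sub, inner_self_eq_norm_sq, inner_self_eq_norm_sq, sub_nonneg]
    exact pow_le_pow_left₀ (norm_nonneg _) (norm_sum_kerFun_le b vv) 2

/-- The de Branges–Rovnyak space `ℋ(b)`. -/
def DeBrangesRovnyak (b : SchurClass d J K) : Type _ := RKHS.OfKernel (dbrKernel b)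

instance (b : SchurClass d J K) : NormedAddCommGroup (DeBrangesRovnyak b) :=
  inferInstanceAs (NormedAddCommGroup (RKHS.OfKernel (dbrKernel b)))
instance (b : SchurClass d J K) : InnerProductSpace ℂ (DeBrangesRovnyak b) :=
  inferInstanceAs (InnerProductSpace ℂ (RKHS.OfKernel (dbrKernel b)))
instance (b : SchurClass d J K) : CompleteSpace (DeBrangesRovnyak b) :=
  inferInstanceAs (CompleteSpace (RKHS.OfKernel (dbrKernel b)))
instance (b : SchurClass d J K) : RKHS ℂ (DeBrangesRovnyak b) (UnitBall d) K :=
  inferInstanceAs (RKHS ℂ (RKHS.OfKernel (dbrKernel b)) (UnitBall d) K)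

theorem kernel_deBrangesRovnyak (b : SchurClass d J K) :
    RKHS.kernel (DeBrangesRovnyak b) = dbrKernel b :=
  RKHS.OfKernel.kernel_ofKernel

/-! ### Gleason solutions and quasi-extreme multipliers -/

/-- `k_0^b : K → ℋ(b)`. -/
def kernelAtOrigin (b : SchurClass d J K) : K →L[ℂ] DeBrangesRovnyak b :=
  RKHS.kerFun (DeBrangesRovnyak b) (origin d)

/-- `X` is a contractive Gleason solution for `ℋ(b)`: `∑ z_j (X_j^* f)(z) = f(z) - f(0)` and
`X X^* ≤ I - k_0 k_0^*`. -/
def IsContractiveGleason (b : SchurClass d J K)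
    (X : Copies d (DeBrangesRovnyak b) →L[ℂ] DeBrangesRovnyak b) : Prop :=
  (∀ (f : DeBrangesRovnyak b) (z : UnitBall d),
    ∑ j, z.1 j • (((X†) f) j) z = f z - f (origin d)) ∧
  X ∘L X† ≤ 1 - kernelAtOrigin b ∘L (kernelAtOrigin b)†

/-- Extremality: `X X^* = I - k_0 k_0^*`. -/
def IsExtremal (b : SchurClass d J K)
    (X : Copies d (DeBrangesRovnyak b) →L[ℂ] DeBrangesRovnyak b) : Prop :=
  X ∘L X† = 1 - kernelAtOrigin b ∘L (kernelAtOrigin b)†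

/-- `X` is the unique contractive Gleason solution for `ℋ(b)`, and it is extremal. -/
def IsUniqueExtremalGleason (b : SchurClass d J K)
    (X : Copies d (DeBrangesRovnyak b) →L[ℂ] DeBrangesRovnyak b) : Prop :=
  IsContractiveGleason b X ∧ IsExtremal b X ∧ ∀ Y, IsContractiveGleason b Y → Y = X

/-- `B` is a contractive Gleason solution for `b`: `b(z) - b(0) = ∑ z_j B_j(z)` and
`B^* B ≤ I - b(0)^* b(0)`. -/
def IsContractiveGleasonFor (b : SchurClass d J K)
    (B : J →L[ℂ] Copies d (DeBrangesRovnyak b)) : Prop :=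
  (∀ (z : UnitBall d) (h : J), b z h - b (origin d) h = ∑ j, z.1 j • ((B h) j) z) ∧
  B† ∘L B ≤ 1 - (b (origin d))† ∘L b (origin d)

/-- A quasi-extreme multiplier: purely contractive, with a unique contractive Gleason solution,
which is extremal. -/
def IsQuasiExtreme (b : SchurClass d J K) : Prop :=
  (∀ z, IsPure (b z)) ∧
  ∃ B, IsContractiveGleasonFor b B ∧ B† ∘L B = 1 - (b (origin d))† ∘L b (origin d) ∧
    ∀ B', IsContractiveGleasonFor b B' → B' = B

end Spaces

/-! ### Characteristic functions of row contractions, QE row contractions -/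

section QE

variable {d : ℕ} {H : Type u} [NormedAddCommGroup H] [InnerProductSpace ℂ H] [CompleteSpace H]

/-- `b` is a characteristic function of `T`: a Schur class function coinciding weakly with the
`δ_T`-Frostman shift of `b_V`, for some model triple of the partial isometric part `V` of `T`. -/
def IsCharacteristicFunction (T : Copies d H →L[ℂ] H)
    {J : Type u} [NormedAddCommGroup J] [InnerProductSpace ℂ J] [CompleteSpace J]
    {K : Type u} [NormedAddCommGroup K] [InnerProductSpace ℂ K] [CompleteSpace K]
    (b : SchurClass d J K) : Prop :=
  ∃ (Jinf : Type u) (_ : NormedAddCommGroup Jinf) (_ : InnerProductSpace ℂ Jinf)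
    (_ : CompleteSpace Jinf)
    (J₀ : Type u) (_ : NormedAddCommGroup J₀) (_ : InnerProductSpace ℂ J₀) (_ : CompleteSpace J₀)
    (γ : ModelTriple (isometricPart T) Jinf J₀) (bT : UnitBall d → Jinf →L[ℂ] J₀),
    IsFrostmanShift (γ.zeroPoint T) γ.charFun bT ∧ WeaklyCoincide bT b.toFun

/-- QE row contractions: CCNC row contractions whose characteristic function coincides weakly with
a quasi-extreme multiplier. -/
def IsQE (T : Copies d H →L[ℂ] H) : Prop :=
  IsRowContraction T ∧ IsCCNC T ∧
  ∃ (J : Type u) (_ : NormedAddCommGroup J) (_ : InnerProductSpace ℂ J) (_ : CompleteSpace J)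
    (_ : TopologicalSpace.SeparableSpace J)
    (K : Type u) (_ : NormedAddCommGroup K) (_ : InnerProductSpace ℂ K) (_ : CompleteSpace K)
    (_ : TopologicalSpace.SeparableSpace K)
    (b : SchurClass d J K), IsQuasiExtreme b ∧ IsCharacteristicFunction T b

end QE

end RowModel

end

open RowModel

/-! All three assertions pass through one coordinate-free notion of model. A total family `Γ(w) : K
→ H` with `Γ(z)^*Γ(w) = k^b(z,w)` is a copy of the kernel maps of `ℋ(b)` in `H`. The operator `T` is
modelled by `b` through `Γ` when `Γ(w) = Γ(0) + T w^*Γ(w)`, `TT^* = I - Γ(0)Γ(0)^*` and `Γ(0)` is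
injective. The recursion says `Γ(w) = (I - Tw^*)⁻¹Γ(0)`, so `T` and `Γ(0)` determine the family.
Taking `H = ℋ(b)` and `Γ(w) = k_w`, the first two conditions say that `T` is an extremal Gleason
solution (`recursion_iff`, `isExtremal_iff`).

Weak coincidence of `b` and `b'` means that `b(z)b(w)^*` and `b'(z)b'(w)^*` agree up to one unitary
of the coefficient spaces (`weaklyCoincide_iff`). Models can therefore be moved along weak
coincidence, and two functions modelling the same `T` coincide weakly
(`weaklyCoincide_of_isExtremalFor`).

A CCNC row contraction is modelled by its characteristic function. Solving the defining equations
gives `b_V(z) = γ(0)^*(I - zV^*)⁻¹zγ(∞)` (`charFun_apply`), and the Frostman shift replaces `V` by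
`T`: `b_T(z) = δ + D_{δ^*}γ(0)^*(I - zT^*)⁻¹zγ(∞)D_δ` (`frostman_apply`). The family is `(I -
Tw^*)⁻¹γ(0)D_{δ^*}`, and the kernel identity (`isKernelFamily_family`) is a computation with
`γ(0)D_{δ^*}²γ(0)^* = I - TT^*` and `γ(∞)D_δ²γ(∞)^* = I - T^*T`.

Gleason solutions for `ℋ(b)` and for `b` are linked by `X^*k_w g = w^*k_w g - B b(w)^*g`. An
extremal `B` yields an extremal `X` (`exists_isExtremalFor`), and every contractive `X` arises from
some contractive `B` (`exists_isContractiveGleasonFor`). Hence uniqueness of `B` forces uniqueness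
of `X`, and any `T` modelled by a quasi-extreme function is unitarily equivalent to the one Gleason
solution. -/

noncomputable section

set_option linter.unusedSectionVars false

namespace RowModel

/-! ### Operator inequalities and extension of operators from total families -/

section Hilbert

variable {E : Type*} [NormedAddCommGroup E] [InnerProductSpace ℂ E]
variable {F : Type*} [NormedAddCommGroup F] [InnerProductSpace ℂ F]
variable {G : Type*} [NormedAddCommGroup G] [InnerProductSpace ℂ G]

theorem inner_adjoint_comp_self [CompleteSpace E] [CompleteSpace F] (A : E →L[ℂ] F) (x y : E) :
    inner ℂ ((A† ∘L A) x) y = inner ℂ (A x) (A y) := by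
  simp [ContinuousLinearMap.adjoint_inner_left]

theorem inner_one_sub_adjoint_comp_self [CompleteSpace E] [CompleteSpace G] (B : E →L[ℂ] G)
    (x y : E) : inner ℂ ((1 - B† ∘L B) x) y = inner ℂ x y - inner ℂ (B x) (B y) := by
  rw [sub_apply, inner_sub_left, inner_adjoint_comp_self]; rfl

theorem inner_self_eq_ofReal (x : E) : inner ℂ x x = ((‖x‖ ^ 2 : ℝ) : ℂ) := by
  rw [inner_self_eq_norm_sq_to_K]; norm_cast

/-- Both sides compare the same quadratic forms. This turns the Gleason inequalities into norm
inequalities, which can be checked on a dense set. -/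
theorem adjoint_comp_self_le_iff [CompleteSpace E] [CompleteSpace F] [CompleteSpace G]
    (A : E →L[ℂ] F) (B : E →L[ℂ] G) :
    A† ∘L A ≤ 1 - B† ∘L B ↔ ∀ x, ‖A x‖ ^ 2 + ‖B x‖ ^ 2 ≤ ‖x‖ ^ 2 := by
  have key : ∀ x, inner ℂ ((1 - B† ∘L B - A† ∘L A) x) x =
      ((‖x‖ ^ 2 - ‖B x‖ ^ 2 - ‖A x‖ ^ 2 : ℝ) : ℂ) := fun x => by
    rw [sub_apply, inner_sub_left, inner_one_sub_adjoint_comp_self,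
      inner_adjoint_comp_self, inner_self_eq_ofReal, inner_self_eq_ofReal, inner_self_eq_ofReal]
    push_cast; ring
  rw [ContinuousLinearMap.le_def, ContinuousLinearMap.isPositive_iff_complex]
  simp only [key]
  refine forall_congr' fun x => ⟨fun h => ?_, fun h => ⟨?_, ?_⟩⟩
  · have := h.2
    rw [RCLike.re_eq_complex_re, Complex.ofReal_re] at this
    linarith
  · rw [RCLike.re_eq_complex_re, Complex.ofReal_re]
  · rw [RCLike.re_eq_complex_re, Complex.ofReal_re]
    linarith

theorem adjoint_comp_self_eq_iff [CompleteSpace E] [CompleteSpace F] [CompleteSpace G]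
    (A : E →L[ℂ] F) (B : E →L[ℂ] G) :
    A† ∘L A = 1 - B† ∘L B ↔ ∀ x, ‖A x‖ ^ 2 + ‖B x‖ ^ 2 = ‖x‖ ^ 2 := by
  rw [← ContinuousLinearMap.coe_inj, ← ext_inner_map]
  refine forall_congr' fun x => ?_
  simp only [ContinuousLinearMap.coe_coe]
  rw [inner_one_sub_adjoint_comp_self,
      inner_adjoint_comp_self, inner_self_eq_ofReal, inner_self_eq_ofReal, inner_self_eq_ofReal,
      ← Complex.ofReal_sub, Complex.ofReal_inj, eq_sub_iff_add_eq]

theorem inner_add_inner_of_adjoint_comp_self_eq [CompleteSpace E] [CompleteSpace F]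
    [CompleteSpace G] {A : E →L[ℂ] F} {B : E →L[ℂ] G} (h : A† ∘L A = 1 - B† ∘L B) (x y : E) :
    inner ℂ (A x) (A y) = inner ℂ x y - inner ℂ (B x) (B y) := by
  rw [← inner_adjoint_comp_self, h, inner_one_sub_adjoint_comp_self]

/-- A family is total if only `0` is orthogonal to it. -/
def IsTotal {ι : Type*} (u : ι → E) : Prop := ∀ x, (∀ i, inner ℂ (u i) x = 0) → x = 0

theorem IsTotal.denseRange [CompleteSpace E] {ι : Type*} {u : ι → E} (hu : IsTotal u) :
    DenseRange (Finsupp.linearCombination ℂ u) := by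
  have h : (Submodule.span ℂ (Set.range u)).topologicalClosure = ⊤ := by
    rw [Submodule.topologicalClosure_eq_top_iff, Submodule.eq_bot_iff]
    exact fun x hx => hu x fun i => hx _ (Submodule.subset_span ⟨i, rfl⟩)
  rw [← Finsupp.range_linearCombination] at h
  have := (Submodule.dense_iff_topologicalClosure_eq_top).mpr h
  rwa [LinearMap.coe_range] at this

theorem IsTotal.ext [CompleteSpace E] {ι : Type*} {u : ι → E} (hu : IsTotal u)
    {A B : E →L[ℂ] F} (h : ∀ i, A (u i) = B (u i)) : A = B := by
  refine ContinuousLinearMap.ext fun x => ?_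
  refine congrFun (hu.denseRange.equalizer A.continuous B.continuous (funext fun c => ?_)) x
  simp [Finsupp.linearCombination_apply, Finsupp.sum, map_sum, h]

theorem inner_linearCombination {ι : Type*} (u : ι → E) (c : ι →₀ ℂ) :
    ((‖Finsupp.linearCombination ℂ u c‖ ^ 2 : ℝ) : ℂ) =
      c.sum fun i a => c.sum fun j b => conj a * b * inner ℂ (u i) (u j) := by
  rw [← inner_self_eq_ofReal, Finsupp.linearCombination_apply, Finsupp.sum_inner]
  refine Finsupp.sum_congr fun i _ => ?_
  rw [Finsupp.inner_sum]
  refine Finsupp.sum_congr fun j _ => ?_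
  rw [inner_smul_left, inner_smul_right]
  ring

theorem linearCombination_map {ι : Type*} (S : E →L[ℂ] F) (u : ι → E) (c : ι →₀ ℂ) :
    Finsupp.linearCombination ℂ (fun i => S (u i)) c = S (Finsupp.linearCombination ℂ u c) := by
  simp [Finsupp.linearCombination_apply, Finsupp.sum, map_sum]

theorem norm_linearCombination_add {ι : Type*} (u : ι → E) (v : ι → F) (w : ι → G)
    (h : ∀ i j, inner ℂ (v i) (v j) + inner ℂ (w i) (w j) = inner ℂ (u i) (u j)) (c : ι →₀ ℂ) :
    ‖Finsupp.linearCombination ℂ v c‖ ^ 2 + ‖Finsupp.linearCombination ℂ w c‖ ^ 2 =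
      ‖Finsupp.linearCombination ℂ u c‖ ^ 2 := by
  apply Complex.ofReal_injective
  simp only [Complex.ofReal_add, inner_linearCombination, ← Finsupp.sum_add]
  refine Finsupp.sum_congr fun i _ => ?_
  refine Finsupp.sum_congr fun j _ => ?_
  rw [← h, mul_add]

/-- An identity between sums of Gram matrices passes to norms of all finite combinations. Three
terms are needed on each side when one pair is controlled afterwards only by an inequality. -/
theorem norm_linearCombination_add₃ {ι : Type*} {E₁ E₂ E₃ F₁ F₂ F₃ : Type*}
    [NormedAddCommGroup E₁] [InnerProductSpace ℂ E₁] [NormedAddCommGroup E₂]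
    [InnerProductSpace ℂ E₂] [NormedAddCommGroup E₃] [InnerProductSpace ℂ E₃]
    [NormedAddCommGroup F₁] [InnerProductSpace ℂ F₁] [NormedAddCommGroup F₂]
    [InnerProductSpace ℂ F₂] [NormedAddCommGroup F₃] [InnerProductSpace ℂ F₃]
    (u₁ : ι → E₁) (u₂ : ι → E₂) (u₃ : ι → E₃) (v₁ : ι → F₁) (v₂ : ι → F₂) (v₃ : ι → F₃)
    (h : ∀ i j, inner ℂ (v₁ i) (v₁ j) + inner ℂ (v₂ i) (v₂ j) + inner ℂ (v₃ i) (v₃ j) =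
      inner ℂ (u₁ i) (u₁ j) + inner ℂ (u₂ i) (u₂ j) + inner ℂ (u₃ i) (u₃ j)) (c : ι →₀ ℂ) :
    ‖Finsupp.linearCombination ℂ v₁ c‖ ^ 2 + ‖Finsupp.linearCombination ℂ v₂ c‖ ^ 2 +
      ‖Finsupp.linearCombination ℂ v₃ c‖ ^ 2 = ‖Finsupp.linearCombination ℂ u₁ c‖ ^ 2 +
      ‖Finsupp.linearCombination ℂ u₂ c‖ ^ 2 + ‖Finsupp.linearCombination ℂ u₃ c‖ ^ 2 := by
  apply Complex.ofReal_injective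
  simp only [Complex.ofReal_add, inner_linearCombination, ← Finsupp.sum_add]
  refine Finsupp.sum_congr fun i _ => ?_
  refine Finsupp.sum_congr fun j _ => ?_
  rw [← mul_add, ← mul_add, h, mul_add, mul_add]

/-- The bound on combinations makes `u i ↦ v i` well defined and contractive on a dense subspace.
The inequality with `S` is a closed condition, so it survives the extension. -/
theorem IsTotal.exists_extension [CompleteSpace E] [CompleteSpace F] {ι : Type*} {u : ι → E}
    (hu : IsTotal u) (v : ι → F) (S : E →L[ℂ] G)
    (h : ∀ c : ι →₀ ℂ, ‖Finsupp.linearCombination ℂ v c‖ ^ 2 +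
      ‖S (Finsupp.linearCombination ℂ u c)‖ ^ 2 ≤ ‖Finsupp.linearCombination ℂ u c‖ ^ 2) :
    ∃ A : E →L[ℂ] F, (∀ i, A (u i) = v i) ∧ ∀ x, ‖A x‖ ^ 2 + ‖S x‖ ^ 2 ≤ ‖x‖ ^ 2 := by
  have hb : ∀ c, ‖Finsupp.linearCombination ℂ v c‖ ≤ 1 * ‖Finsupp.linearCombination ℂ u c‖ := by
    intro c
    rw [one_mul]
    refine abs_le_of_sq_le_sq' ?_ (norm_nonneg _) |>.2
    nlinarith [h c, sq_nonneg ‖S (Finsupp.linearCombination ℂ u c)‖]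
  have hA := LinearMap.extendOfNorm_eq (f := Finsupp.linearCombination ℂ v)
    (e := Finsupp.linearCombination ℂ u) hu.denseRange ⟨1, hb⟩
  refine ⟨(Finsupp.linearCombination ℂ v).extendOfNorm (Finsupp.linearCombination ℂ u),
    fun i => ?_, fun x => ?_⟩
  · simpa using hA (Finsupp.single i 1)
  · refine hu.denseRange.induction_on (p := fun x => ‖LinearMap.extendOfNorm
      (Finsupp.linearCombination ℂ v) (Finsupp.linearCombination ℂ u) x‖ ^ 2 + ‖S x‖ ^ 2 ≤
      ‖x‖ ^ 2) x (isClosed_le (by fun_prop) (by fun_prop)) fun c => ?_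
    rw [hA]
    exact h c

theorem IsTotal.exists_extension_of_inner [CompleteSpace E] [CompleteSpace F] {ι : Type*}
    {u : ι → E} (hu : IsTotal u) (v : ι → F) (S : E →L[ℂ] G)
    (h : ∀ i j, inner ℂ (v i) (v j) + inner ℂ (S (u i)) (S (u j)) = inner ℂ (u i) (u j)) :
    ∃ A : E →L[ℂ] F, (∀ i, A (u i) = v i) ∧ ∀ x, ‖A x‖ ^ 2 + ‖S x‖ ^ 2 = ‖x‖ ^ 2 := by
  have hc : ∀ c : ι →₀ ℂ, ‖Finsupp.linearCombination ℂ v c‖ ^ 2 +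
      ‖S (Finsupp.linearCombination ℂ u c)‖ ^ 2 = ‖Finsupp.linearCombination ℂ u c‖ ^ 2 := by
    intro c
    rw [← norm_linearCombination_add u v (fun i => S (u i)) h c]
    simp [Finsupp.linearCombination_apply, Finsupp.sum, map_sum]
  obtain ⟨A, hA, -⟩ := hu.exists_extension v S fun c => (hc c).le
  refine ⟨A, hA, fun x => ?_⟩
  refine hu.denseRange.induction_on (p := fun x => ‖A x‖ ^ 2 + ‖S x‖ ^ 2 = ‖x‖ ^ 2) x
    (isClosed_eq (by fun_prop) (by fun_prop)) fun c => ?_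
  rw [← hc c]
  simp [Finsupp.linearCombination_apply, Finsupp.sum, map_sum, hA]

theorem IsTotal.exists_linearIsometryEquiv [CompleteSpace E] [CompleteSpace F] {ι : Type*}
    {u : ι → E} (hu : IsTotal u) {v : ι → F} (hv : IsTotal v)
    (h : ∀ i j, inner ℂ (v i) (v j) = inner ℂ (u i) (u j)) :
    ∃ U : E ≃ₗᵢ[ℂ] F, ∀ i, U (u i) = v i := by
  have hn : ∀ c : ι →₀ ℂ, ‖Finsupp.linearCombination ℂ v c‖ = ‖Finsupp.linearCombination ℂ u c‖ :=
    fun c => by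
      have := norm_linearCombination_add u v (fun _ => (0 : E)) (by simpa using h) c
      have h0 : Finsupp.linearCombination ℂ (fun _ : ι => (0 : E)) c = 0 := by
        simp [Finsupp.linearCombination_apply]
      rw [h0] at this
      refine (sq_eq_sq₀ (norm_nonneg _) (norm_nonneg _)).mp ?_
      simpa using this
  obtain ⟨A, hA, hA'⟩ := hu.exists_extension_of_inner v (0 : E →L[ℂ] E) (by simpa using h)
  obtain ⟨B, hB, -⟩ := hv.exists_extension_of_inner u (0 : F →L[ℂ] F) (by simp [h])
  have hBA : B ∘L A = ContinuousLinearMap.id ℂ E := hu.ext fun i => by simp [hA, hB]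
  have hAB : A ∘L B = ContinuousLinearMap.id ℂ F := hv.ext fun i => by simp [hA, hB]
  refine ⟨⟨LinearEquiv.ofLinearMap A.toLinearMap B.toLinearMap ?_ ?_, fun x => ?_⟩, fun i => hA i⟩
  · exact LinearMap.ext fun x => DFunLike.congr_fun hAB x
  · exact LinearMap.ext fun x => DFunLike.congr_fun hBA x
  · refine (sq_eq_sq₀ (norm_nonneg _) (norm_nonneg _)).mp ?_
    simpa using hA' x

end Hilbert

/-! ### Defect operators -/

section Defect

variable {E : Type*} [NormedAddCommGroup E] [InnerProductSpace ℂ E] [CompleteSpace E]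
variable {F : Type*} [NormedAddCommGroup F] [InnerProductSpace ℂ F] [CompleteSpace F]

theorem one_sub_adjoint_comp_self_nonneg {T : E →L[ℂ] F} (hT : ‖T‖ ≤ 1) : 0 ≤ 1 - T† ∘L T := by
  rw [sub_nonneg]
  have h := (adjoint_comp_self_le_iff T (0 : E →L[ℂ] E)).mpr fun x => by
    have : ‖T x‖ ≤ ‖x‖ := T.le_of_opNorm_le hT x |>.trans_eq (one_mul _)
    simpa using pow_le_pow_left₀ (norm_nonneg _) this 2
  simpa using h

theorem defect_nonneg (T : E →L[ℂ] F) : 0 ≤ defect T := CFC.sqrt_nonneg _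

theorem adjoint_defect (T : E →L[ℂ] F) : (defect T)† = defect T :=
  (defect_nonneg T).isSelfAdjoint

theorem inner_defect_left (T : E →L[ℂ] F) (x y : E) :
    inner ℂ (defect T x) y = inner ℂ x (defect T y) := by
  rw [← ContinuousLinearMap.adjoint_inner_right, adjoint_defect]

theorem defect_mul_self {T : E →L[ℂ] F} (hT : ‖T‖ ≤ 1) :
    defect T * defect T = 1 - T† ∘L T :=
  CFC.sqrt_mul_sqrt_self _ (one_sub_adjoint_comp_self_nonneg hT)

theorem defect_defect {T : E →L[ℂ] F} (hT : ‖T‖ ≤ 1) (x : E) :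
    defect T (defect T x) = x - (T†) (T x) := by
  simpa using DFunLike.congr_fun (defect_mul_self hT) x

theorem defect_eq_zero_iff {T : E →L[ℂ] F} (hT : ‖T‖ ≤ 1) (x : E) :
    defect T x = 0 ↔ (T†) (T x) = x := by
  refine ⟨fun h => ?_, fun h => ?_⟩
  · have := defect_defect hT x
    rw [h, map_zero] at this
    exact (sub_eq_zero.mp this.symm).symm
  · rw [← inner_self_eq_zero (𝕜 := ℂ), inner_defect_left, defect_defect hT, h, sub_self,
      inner_zero_right]

theorem norm_adjoint_le_one {T : E →L[ℂ] F} (hT : ‖T‖ ≤ 1) : ‖T†‖ ≤ 1 := by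
  rwa [LinearIsometryEquiv.norm_map]

/-- Multiplying by `Q` on the right gives `(QZ)(QZ)^* = 0`. -/
theorem comp_eq_zero_of_comp_comp_adjoint_eq_zero {Q : F →L[ℂ] F} {Z : E →L[ℂ] F}
    (hQ : Q† = Q) (h : Q ∘L Z ∘L Z† = 0) : Q ∘L Z = 0 := by
  have h1 : ∀ x, (Z†) (Q x) = 0 := fun x => by
    rw [← inner_self_eq_zero (𝕜 := ℂ), ContinuousLinearMap.adjoint_inner_left, ← hQ,
      ContinuousLinearMap.adjoint_inner_left]
    have := DFunLike.congr_fun h (Q x)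
    simp only [ContinuousLinearMap.comp_apply] at this
    rw [hQ, this]; simp
  refine ContinuousLinearMap.ext fun x => ?_
  rw [zero_apply, ← inner_self_eq_zero (𝕜 := ℂ)]
  change inner ℂ (Q (Z x)) (Q (Z x)) = 0
  nth_rw 1 [← hQ]
  rw [ContinuousLinearMap.adjoint_inner_left, ← ContinuousLinearMap.adjoint_inner_right, h1,
    inner_zero_right]

/-- With `Z = AP - QA` the hypothesis reads `QZ = -ZP`. Then `Q·ZZ^* = -ZPZ^*` is self-adjoint and
nonpositive, while a product of commuting nonnegative operators is nonnegative. So it vanishes,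
which forces `QZ = 0`, `ZP = 0` and finally `ZZ^* = 0`. -/
theorem intertwine_of_sq {P : E →L[ℂ] E} {Q : F →L[ℂ] F} (hP : 0 ≤ P) (hQ : 0 ≤ Q)
    {A : E →L[ℂ] F} (h : A ∘L (P * P) = (Q * Q) ∘L A) : A ∘L P = Q ∘L A := by
  have hP' : P† = P := hP.isSelfAdjoint
  have hQ' : Q† = Q := hQ.isSelfAdjoint
  obtain ⟨Z, hZ⟩ : ∃ Z, Z = A ∘L P - Q ∘L A := ⟨_, rfl⟩
  have hZx : ∀ x, Z x = A (P x) - Q (A x) := fun x => by simp [hZ]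
  have hQZ : Q ∘L Z = -(Z ∘L P) := by
    refine ContinuousLinearMap.ext fun x => ?_
    have : A (P (P x)) = Q (Q (A x)) := DFunLike.congr_fun h x
    simp [hZx, this]
  set W : F →L[ℂ] F := Z ∘L Z† with hW
  have hWpos : 0 ≤ W := by
    rw [ContinuousLinearMap.nonneg_iff_isPositive]
    exact ContinuousLinearMap.isPositive_self_comp_adjoint Z
  have hQW : Q * W = -(Z ∘L P ∘L Z†) := by
    refine ContinuousLinearMap.ext fun x => ?_
    simpa [hW] using DFunLike.congr_fun hQZ ((Z†) x)
  have hZPZ : 0 ≤ Z ∘L P ∘L Z† := by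
    rw [ContinuousLinearMap.nonneg_iff_isPositive] at hP ⊢
    exact hP.conj_adjoint Z
  -- A product of two self-adjoint operators is self-adjoint exactly when they commute.
  have hcomm : Commute Q W := by
    have hs : IsSelfAdjoint (Q * W) := by
      rw [hQW]; exact hZPZ.isSelfAdjoint.neg
    exact (hQ.isSelfAdjoint.commute_iff hWpos.isSelfAdjoint).mpr hs
  have h0 : Q * W = 0 := by
    refine le_antisymm ?_ (hcomm.mul_nonneg hQ hWpos)
    rw [hQW]; simpa using hZPZ
  have hQZ0 : Q ∘L Z = 0 := comp_eq_zero_of_comp_comp_adjoint_eq_zero hQ' h0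
  have hZP0 : ∀ x, Z (P x) = 0 := fun x => by
    have := DFunLike.congr_fun hQZ x
    rw [hQZ0] at this
    simpa using this.symm
  have hZQ : ∀ x, (Z†) (Q x) = 0 := fun x => by
    refine ext_inner_right ℂ fun y => ?_
    rw [ContinuousLinearMap.adjoint_inner_left, ← hQ', ContinuousLinearMap.adjoint_inner_left]
    have := DFunLike.congr_fun hQZ0 y
    simp only [ContinuousLinearMap.comp_apply, zero_apply] at this
    rw [this]; simp
  have hPZ : ∀ y, P ((Z†) y) = 0 := fun y => by
    refine ext_inner_right ℂ fun e => ?_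
    rw [← ContinuousLinearMap.adjoint_inner_right, hP', ContinuousLinearMap.adjoint_inner_left,
      hZP0]; simp
  have hZZ : ∀ y, Z ((Z†) y) = 0 := fun y => by
    rw [← inner_self_eq_zero (𝕜 := ℂ)]
    nth_rw 2 [hZx]
    rw [hPZ, map_zero, zero_sub, inner_neg_right, ← ContinuousLinearMap.adjoint_inner_right, hZQ]
    simp
  have hZ0 : ∀ y, (Z†) y = 0 := fun y => by
    rw [← inner_self_eq_zero (𝕜 := ℂ), ContinuousLinearMap.adjoint_inner_left, hZZ,
      inner_zero_right]
  have hZ00 : Z† = 0 := ContinuousLinearMap.ext hZ0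
  rw [← sub_eq_zero, ← hZ, ← ContinuousLinearMap.adjoint_adjoint Z, hZ00, map_zero]

/-- The squares intertwine, since `A(I - A^*A) = (I - AA^*)A`, hence so do the positive roots. -/
theorem comp_defect {A : E →L[ℂ] F} (hA : ‖A‖ ≤ 1) : A ∘L defect A = defect (A†) ∘L A := by
  refine intertwine_of_sq (defect_nonneg _) (defect_nonneg _) ?_
  rw [defect_mul_self hA, defect_mul_self (norm_adjoint_le_one hA)]
  refine ContinuousLinearMap.ext fun x => ?_
  simp

end Defect

/-! ### Row operators and resolvents -/

section Rows

variable {d : ℕ} {H : Type*} [NormedAddCommGroup H] [InnerProductSpace ℂ H]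
variable {H' : Type*} [NormedAddCommGroup H'] [InnerProductSpace ℂ H']

theorem inner_colStar_colStar (z w : UnitBall d) (x y : H) :
    inner ℂ (colStar H z x) (colStar H w y) = inner ℂ w.1 z.1 * inner ℂ x y := by
  rw [PiLp.inner_apply, PiLp.inner_apply, Finset.sum_mul]
  refine Finset.sum_congr rfl fun j _ => ?_
  simp only [colStar_apply, inner_smul_left, inner_smul_right, RCLike.conj_conj,
    RCLike.inner_apply]
  ring

theorem norm_colStar (z : UnitBall d) (x : H) : ‖colStar H z x‖ = ‖z.1‖ * ‖x‖ := by
  refine (sq_eq_sq₀ (norm_nonneg _) (by positivity)).mp ?_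
  apply Complex.ofReal_injective
  rw [← inner_self_eq_ofReal, inner_colStar_colStar, inner_self_eq_ofReal, inner_self_eq_ofReal]
  push_cast; ring

@[simp] theorem colStar_origin (x : H) : colStar H (origin d) x = 0 := by
  rw [← norm_eq_zero, norm_colStar]
  simp [origin]

theorem ampl_colStar (A : H →L[ℂ] H') (z : UnitBall d) (x : H) :
    ampl d A (colStar H z x) = colStar H' z (A x) := by
  ext j; simp

theorem inner_ampl_left [CompleteSpace H] [CompleteSpace H'] (A : H →L[ℂ] H') (x : Copies d H)
    (y : Copies d H') : inner ℂ (ampl d A x) y = inner ℂ x (ampl d (A†) y) := by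
  rw [PiLp.inner_apply, PiLp.inner_apply]
  simp [ContinuousLinearMap.adjoint_inner_right]

theorem inner_rowMul_left [CompleteSpace H] (z : UnitBall d) (x : Copies d H) (y : H) :
    inner ℂ (rowMul H z x) y = inner ℂ x (colStar H z y) :=
  ContinuousLinearMap.adjoint_inner_left _ _ _

theorem inner_rowMul_right [CompleteSpace H] (z : UnitBall d) (x : H) (y : Copies d H) :
    inner ℂ x (rowMul H z y) = inner ℂ (colStar H z x) y :=
  ContinuousLinearMap.adjoint_inner_right _ _ _

theorem rowMul_ampl [CompleteSpace H] [CompleteSpace H'] (A : H →L[ℂ] H') (z : UnitBall d)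
    (x : Copies d H) : rowMul H' z (ampl d A x) = A (rowMul H z x) := by
  refine ext_inner_right ℂ fun y => ?_
  rw [inner_rowMul_left, inner_ampl_left, ampl_colStar, ← inner_rowMul_left,
    ContinuousLinearMap.adjoint_inner_right]

theorem norm_comp_colStar_lt_one {T : Copies d H →L[ℂ] H} (hT : ‖T‖ ≤ 1) (z : UnitBall d) :
    ‖T ∘L colStar H z‖ < 1 := by
  refine lt_of_le_of_lt (ContinuousLinearMap.opNorm_le_bound _ (norm_nonneg z.1) fun x => ?_)
    (mem_ball_zero_iff.mp z.2)
  calc ‖T (colStar H z x)‖ ≤ 1 * ‖colStar H z x‖ := T.le_of_opNorm_le hT _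
    _ = ‖z.1‖ * ‖x‖ := by rw [one_mul, norm_colStar]

theorem isUnit_one_sub_comp_colStar [CompleteSpace H] {T : Copies d H →L[ℂ] H} (hT : ‖T‖ ≤ 1)
    (z : UnitBall d) : IsUnit (1 - T ∘L colStar H z) :=
  isUnit_one_sub_of_norm_lt_one (norm_comp_colStar_lt_one hT z)

theorem resolvent_sub [CompleteSpace H] {T : Copies d H →L[ℂ] H} (hT : ‖T‖ ≤ 1)
    (z : UnitBall d) (x : H) : resolvent T z (x - T (colStar H z x)) = x := by
  simpa [resolvent] using DFunLike.congr_fun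
    (Ring.inverse_mul_cancel _ (isUnit_one_sub_comp_colStar hT z)) x

theorem sub_resolvent [CompleteSpace H] {T : Copies d H →L[ℂ] H} (hT : ‖T‖ ≤ 1)
    (z : UnitBall d) (x : H) :
    resolvent T z x - T (colStar H z (resolvent T z x)) = x := by
  simpa [resolvent] using DFunLike.congr_fun
    (Ring.mul_inverse_cancel _ (isUnit_one_sub_comp_colStar hT z)) x

theorem resolvent_origin [CompleteSpace H] (T : Copies d H →L[ℂ] H) (x : H) :
    resolvent T (origin d) x = x := by
  have : T ∘L colStar H (origin d) = 0 := ContinuousLinearMap.ext fun x => by simp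
  simp [resolvent, this]

theorem eq_zero_of_eq_comp_colStar {T : Copies d H →L[ℂ] H} (hT : ‖T‖ ≤ 1)
    {z : UnitBall d} {x : H} (h : x = T (colStar H z x)) : x = 0 := by
  by_contra hx
  have h1 : ‖x‖ ≤ ‖T ∘L colStar H z‖ * ‖x‖ := by
    conv_lhs => rw [h]
    exact (T ∘L colStar H z).le_opNorm x
  have h2 := norm_comp_colStar_lt_one hT z
  have h3 : 0 < ‖x‖ := norm_pos_iff.mpr hx
  nlinarith

theorem adjoint_resolvent_sub [CompleteSpace H] {T : Copies d H →L[ℂ] H} (hT : ‖T‖ ≤ 1)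
    (z : UnitBall d) (x : H) :
    ((resolvent T z)†) x - rowMul H z ((T†) (((resolvent T z)†) x)) = x := by
  refine ext_inner_right ℂ fun y => ?_
  rw [inner_sub_left, inner_rowMul_left, ContinuousLinearMap.adjoint_inner_left T,
    ← inner_sub_right, ContinuousLinearMap.adjoint_inner_left, resolvent_sub hT]

/-- The equation says that `x` is orthogonal to the range of `I - Tz^*`, which is everything. -/
theorem eq_zero_of_eq_rowMul_adjoint [CompleteSpace H] {T : Copies d H →L[ℂ] H} (hT : ‖T‖ ≤ 1)
    {z : UnitBall d} {x : H} (h : x = rowMul H z ((T†) x)) : x = 0 := by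
  refine ext_inner_right ℂ fun y => ?_
  have : inner ℂ x (resolvent T z y - T (colStar H z (resolvent T z y))) = 0 := by
    rw [inner_sub_right, ← ContinuousLinearMap.adjoint_inner_left T, ← inner_rowMul_left, ← h,
      sub_self]
  rwa [sub_resolvent hT, ← inner_zero_left y] at this

end Rows

/-! ### Unitary equivalence -/

section UnitaryEquivalence

variable {d : ℕ} {H : Type*} [NormedAddCommGroup H] [InnerProductSpace ℂ H]
variable {H' : Type*} [NormedAddCommGroup H'] [InnerProductSpace ℂ H']
variable {H'' : Type*} [NormedAddCommGroup H''] [InnerProductSpace ℂ H'']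

/-- A unitary as a bounded operator. -/
abbrev unitaryOp (U : H ≃ₗᵢ[ℂ] H') : H →L[ℂ] H' := (U.toContinuousLinearEquiv : H →L[ℂ] H')

theorem ampl_unitaryOp_symm (U : H ≃ₗᵢ[ℂ] H') (x : Copies d H') :
    ampl d (unitaryOp U) (ampl d (unitaryOp U.symm) x) = x := by
  ext j; simp

theorem ampl_symm_unitaryOp (U : H ≃ₗᵢ[ℂ] H') (x : Copies d H) :
    ampl d (unitaryOp U.symm) (ampl d (unitaryOp U) x) = x := by
  ext j; simp

theorem inner_ampl_unitaryOp (U : H ≃ₗᵢ[ℂ] H') (x y : Copies d H) :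
    inner ℂ (ampl d (unitaryOp U) x) (ampl d (unitaryOp U) y) = inner ℂ x y := by
  rw [PiLp.inner_apply, PiLp.inner_apply]
  simp

theorem norm_ampl_unitaryOp (U : H ≃ₗᵢ[ℂ] H') (x : Copies d H) :
    ‖ampl d (unitaryOp U) x‖ = ‖x‖ := by
  rw [@norm_eq_sqrt_re_inner ℂ, inner_ampl_unitaryOp, ← norm_eq_sqrt_re_inner]

/-- The row operator `U T (U ⊗ I)^*`. -/
def conjRow (U : H ≃ₗᵢ[ℂ] H') (T : Copies d H →L[ℂ] H) : Copies d H' →L[ℂ] H' :=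
  unitaryOp U ∘L T ∘L ampl d (unitaryOp U.symm)

theorem conjRow_ampl (U : H ≃ₗᵢ[ℂ] H') (T : Copies d H →L[ℂ] H) (x : Copies d H) :
    U (T x) = conjRow U T (ampl d (unitaryOp U) x) := by
  simp [conjRow, ampl_symm_unitaryOp]

theorem unitarilyEquivalent_conjRow (U : H ≃ₗᵢ[ℂ] H') (T : Copies d H →L[ℂ] H) :
    UnitarilyEquivalent T (conjRow U T) := ⟨U, conjRow_ampl U T⟩

theorem conjRow_injective (U : H ≃ₗᵢ[ℂ] H') :
    Function.Injective (conjRow (d := d) U) := fun T S h => by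
  refine ContinuousLinearMap.ext fun x => U.injective ?_
  rw [conjRow_ampl, conjRow_ampl, h]

theorem UnitarilyEquivalent.symm {T : Copies d H →L[ℂ] H} {T' : Copies d H' →L[ℂ] H'}
    (h : UnitarilyEquivalent T T') : UnitarilyEquivalent T' T := by
  obtain ⟨U, hU⟩ := h
  refine ⟨U.symm, fun x => ?_⟩
  rw [LinearIsometryEquiv.symm_apply_eq, hU]
  exact congrArg T' (ampl_unitaryOp_symm U x).symm

theorem UnitarilyEquivalent.trans {T : Copies d H →L[ℂ] H} {T' : Copies d H' →L[ℂ] H'}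
    {T'' : Copies d H'' →L[ℂ] H''} (h : UnitarilyEquivalent T T')
    (h' : UnitarilyEquivalent T' T'') : UnitarilyEquivalent T T'' := by
  obtain ⟨U, hU⟩ := h
  obtain ⟨U', hU'⟩ := h'
  refine ⟨U.trans U', fun x => ?_⟩
  rw [LinearIsometryEquiv.trans_apply, hU, hU']
  rfl

theorem adjoint_apply_of_intertwine [CompleteSpace H] [CompleteSpace H'] {U : H ≃ₗᵢ[ℂ] H'}
    {T : Copies d H →L[ℂ] H} {T' : Copies d H' →L[ℂ] H'}
    (hU : ∀ x, U (T x) = T' (ampl d (unitaryOp U) x)) (y : H) :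
    (T'†) (U y) = ampl d (unitaryOp U) ((T†) y) := by
  refine ext_inner_right ℂ fun x => ?_
  rw [← ampl_unitaryOp_symm U x, ContinuousLinearMap.adjoint_inner_left, ← hU,
    LinearIsometryEquiv.inner_map_map, inner_ampl_unitaryOp,
    ContinuousLinearMap.adjoint_inner_left]

end UnitaryEquivalence

/-! ### Weak coincidence -/

section WeakCoincidence

variable {d : ℕ}
variable {J : Type*} [NormedAddCommGroup J] [InnerProductSpace ℂ J] [CompleteSpace J]
variable {K : Type*} [NormedAddCommGroup K] [InnerProductSpace ℂ K] [CompleteSpace K]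
variable {J' : Type*} [NormedAddCommGroup J'] [InnerProductSpace ℂ J'] [CompleteSpace J']
variable {K' : Type*} [NormedAddCommGroup K'] [InnerProductSpace ℂ K'] [CompleteSpace K']

theorem adjoint_mem_supp (b : UnitBall d → J →L[ℂ] K) (z : UnitBall d) (g : K) :
    ((b z)†) g ∈ supp b :=
  Submodule.le_topologicalClosure _ (Submodule.mem_iSup_of_mem z ⟨g, rfl⟩)

instance (b : UnitBall d → J →L[ℂ] K) : CompleteSpace (supp b) :=
  (Submodule.isClosed_topologicalClosure _).completeSpace_coe

/-- The vectors `b(z)^* g`, as elements of the support of `b`. -/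
def suppVec (b : UnitBall d → J →L[ℂ] K) (p : UnitBall d × K) : supp b :=
  ⟨((b p.1)†) p.2, adjoint_mem_supp b p.1 p.2⟩

theorem isTotal_suppVec (b : UnitBall d → J →L[ℂ] K) : IsTotal (suppVec b) := fun x hx => by
  have h : (x : J) ∈ (supp b)ᗮ := by
    change (x : J) ∈ (Submodule.topologicalClosure _)ᗮ
    rw [Submodule.orthogonal_closure, Submodule.mem_orthogonal]
    intro y hy
    induction hy using Submodule.iSup_induction' with
    | mem z y hy =>
      obtain ⟨g, rfl⟩ := hy
      exact hx (z, g)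
    | zero => simp
    | add y y' _ _ h h' => rw [inner_add_left, h, h', add_zero]
  have : inner ℂ (x : J) (x : J) = 0 := h _ x.2
  exact Subtype.ext (inner_self_eq_zero.mp this)

/-- Weak coincidence, in terms of the kernel `b(z) b(w)^*`. -/
theorem weaklyCoincide_iff {b : UnitBall d → J →L[ℂ] K} {b' : UnitBall d → J' →L[ℂ] K'} :
    WeaklyCoincide b b' ↔ ∃ R : K ≃ₗᵢ[ℂ] K', ∀ z w g g',
      inner ℂ (((b' z)†) (R g)) (((b' w)†) (R g')) = inner ℂ (((b z)†) g) (((b w)†) g') := by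
  constructor
  · rintro ⟨R, Q, h⟩
    refine ⟨R, fun z w g g' => ?_⟩
    -- Taking adjoints in `R b(z) = b'(z) Q` on the supports gives `Q b(z)^* = b'(z)^* R`.
    have key : ∀ p, Q (suppVec b p) = suppVec b' (p.1, R p.2) := fun p => by
      refine ext_inner_right ℂ fun y => ?_
      obtain ⟨x, rfl⟩ := Q.surjective y
      rw [Q.inner_map_map]
      change inner ℂ (((b p.1)†) p.2) (x : J) = inner ℂ (((b' p.1)†) (R p.2)) (Q x : J')
      rw [ContinuousLinearMap.adjoint_inner_left, ContinuousLinearMap.adjoint_inner_left,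
        ← R.inner_map_map]
      exact congrArg (inner ℂ (R p.2)) (h p.1 x)
    have := Q.inner_map_map (suppVec b (z, g)) (suppVec b (w, g'))
    rwa [key, key] at this
  · rintro ⟨R, h⟩
    have htot : IsTotal fun p : UnitBall d × K => suppVec b' (p.1, R p.2) := fun x hx =>
      isTotal_suppVec b' x fun p => by simpa using hx (p.1, R.symm p.2)
    -- The hypothesis is equality of the Gram matrices of two total families, which produces the
    -- unitary between the supports.
    obtain ⟨Q, hQ⟩ := (isTotal_suppVec b).exists_linearIsometryEquiv htot
      fun p q => h p.1 q.1 p.2 q.2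
    refine ⟨R, Q, fun z x => ext_inner_left ℂ fun y => ?_⟩
    obtain ⟨g, rfl⟩ := R.surjective y
    have h1 := Q.inner_map_map (suppVec b (z, g)) x
    rw [hQ] at h1
    change inner ℂ (((b' z)†) (R g)) (Q x : J') = inner ℂ (((b z)†) g) (x : J) at h1
    rw [ContinuousLinearMap.adjoint_inner_left, ContinuousLinearMap.adjoint_inner_left] at h1
    rw [R.inner_map_map]
    exact h1.symm

end WeakCoincidence

/-! ### Model families and Gleason solutions in a Hilbert space -/

section Family

variable {d : ℕ}
variable {J : Type*} [NormedAddCommGroup J] [InnerProductSpace ℂ J] [CompleteSpace J]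
variable {K : Type*} [NormedAddCommGroup K] [InnerProductSpace ℂ K] [CompleteSpace K]
variable {J' : Type*} [NormedAddCommGroup J'] [InnerProductSpace ℂ J'] [CompleteSpace J']
variable {K' : Type*} [NormedAddCommGroup K'] [InnerProductSpace ℂ K'] [CompleteSpace K']
variable {H : Type*} [NormedAddCommGroup H] [InnerProductSpace ℂ H] [CompleteSpace H]
variable {H' : Type*} [NormedAddCommGroup H'] [InnerProductSpace ℂ H'] [CompleteSpace H']

/-- A total family `Γ(w) : K → H` factoring the de Branges–Rovnyak kernel of `b`:
`Γ(z)^* Γ(w) = (I - b(z) b(w)^*) / (1 - z w^*)`. -/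
structure IsKernelFamily (b : UnitBall d → J →L[ℂ] K) (Γ : UnitBall d → K →L[ℂ] H) : Prop where
  total : IsTotal fun p : UnitBall d × K => Γ p.1 p.2
  inner_eq : ∀ z w g g', (1 - inner ℂ w.1 z.1) * inner ℂ (Γ z g) (Γ w g') =
    inner ℂ g g' - inner ℂ (((b z)†) g) (((b w)†) g')

/-- `Γ(w) = Γ(0) + T w^* Γ(w)` and `T T^* ≤ I - Γ(0) Γ(0)^*`. -/
structure IsGleasonFor (T : Copies d H →L[ℂ] H) (Γ : UnitBall d → K →L[ℂ] H) : Prop where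
  recursion : ∀ w g, Γ w g = Γ (origin d) g + T (colStar H w (Γ w g))
  norm_le : ∀ x, ‖(T†) x‖ ^ 2 + ‖((Γ (origin d))†) x‖ ^ 2 ≤ ‖x‖ ^ 2

/-- `Γ(w) = Γ(0) + T w^* Γ(w)` and `T T^* = I - Γ(0) Γ(0)^*`. -/
structure IsExtremalFor (T : Copies d H →L[ℂ] H) (Γ : UnitBall d → K →L[ℂ] H) : Prop
    extends IsGleasonFor T Γ where
  norm_eq : ∀ x, ‖(T†) x‖ ^ 2 + ‖((Γ (origin d))†) x‖ ^ 2 = ‖x‖ ^ 2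

theorem one_sub_inner_ne_zero (z w : UnitBall d) : (1 - inner ℂ w.1 z.1 : ℂ) ≠ 0 := by
  intro h
  have := norm_inner_lt_one z w
  rw [← sub_eq_zero.mp h] at this
  simp at this

theorem IsKernelFamily.inner_congr {b : UnitBall d → J →L[ℂ] K} {Γ : UnitBall d → K →L[ℂ] H}
    {Γ' : UnitBall d → K →L[ℂ] H'} (h : IsKernelFamily b Γ) (h' : IsKernelFamily b Γ')
    (z w : UnitBall d) (g g' : K) :
    inner ℂ (Γ' z g) (Γ' w g') = inner ℂ (Γ z g) (Γ w g') := by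
  refine mul_left_cancel₀ (one_sub_inner_ne_zero z w) ?_
  rw [h.inner_eq, h'.inner_eq]

theorem IsKernelFamily.exists_unitary {b : UnitBall d → J →L[ℂ] K} {Γ : UnitBall d → K →L[ℂ] H}
    {Γ' : UnitBall d → K →L[ℂ] H'} (h : IsKernelFamily b Γ) (h' : IsKernelFamily b Γ') :
    ∃ U : H ≃ₗᵢ[ℂ] H', ∀ z g, U (Γ z g) = Γ' z g := by
  obtain ⟨U, hU⟩ := h.total.exists_linearIsometryEquiv h'.total
    fun p q => h.inner_congr h' p.1 q.1 p.2 q.2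
  exact ⟨U, fun z g => hU (z, g)⟩

/-- The kernel involves `b` only through `b(z)b(w)^*`, so the same `H` carries the kernel of `b'`
after a unitary change of coefficients. -/
theorem IsKernelFamily.of_weaklyCoincide {b : UnitBall d → J →L[ℂ] K}
    {b' : UnitBall d → J' →L[ℂ] K'} {Γ : UnitBall d → K →L[ℂ] H} (h : IsKernelFamily b Γ)
    {R : K ≃ₗᵢ[ℂ] K'} (hR : ∀ z w g g',
      inner ℂ (((b' z)†) (R g)) (((b' w)†) (R g')) = inner ℂ (((b z)†) g) (((b w)†) g')) :
    IsKernelFamily b' fun w => Γ w ∘L unitaryOp R.symm where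
  total x hx := h.total x fun p => by simpa using hx (p.1, R p.2)
  inner_eq z w g g' := by
    have h1 := h.inner_eq z w (R.symm g) (R.symm g')
    rw [← hR] at h1
    simpa using h1

theorem adjoint_comp_unitaryOp_symm (A : K →L[ℂ] H) (R : K ≃ₗᵢ[ℂ] K') (x : H) :
    ((A ∘L unitaryOp R.symm)†) x = R ((A†) x) := by
  refine ext_inner_right ℂ fun y => ?_
  rw [ContinuousLinearMap.adjoint_inner_left]
  obtain ⟨y, rfl⟩ := R.surjective y
  simp [ContinuousLinearMap.adjoint_inner_left]

theorem IsGleasonFor.comp_unitary {T : Copies d H →L[ℂ] H} {Γ : UnitBall d → K →L[ℂ] H}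
    (h : IsGleasonFor T Γ) (R : K ≃ₗᵢ[ℂ] K') :
    IsGleasonFor T fun w => Γ w ∘L unitaryOp R.symm where
  recursion w g := h.recursion w (R.symm g)
  norm_le x := by simpa [adjoint_comp_unitaryOp_symm] using h.norm_le x

theorem IsExtremalFor.comp_unitary {T : Copies d H →L[ℂ] H} {Γ : UnitBall d → K →L[ℂ] H}
    (h : IsExtremalFor T Γ) (R : K ≃ₗᵢ[ℂ] K') :
    IsExtremalFor T fun w => Γ w ∘L unitaryOp R.symm where
  toIsGleasonFor := h.toIsGleasonFor.comp_unitary R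
  norm_eq x := by simpa [adjoint_comp_unitaryOp_symm] using h.norm_eq x

theorem adjoint_unitary_apply {U : H ≃ₗᵢ[ℂ] H'} {A : K →L[ℂ] H} {A' : K →L[ℂ] H'}
    (h : ∀ g, U (A g) = A' g) (x : H) : (A'†) (U x) = (A†) x := by
  refine ext_inner_right ℂ fun y => ?_
  rw [ContinuousLinearMap.adjoint_inner_left, ← h, U.inner_map_map,
    ContinuousLinearMap.adjoint_inner_left]

theorem norm_sq_add_of_intertwine {U : H ≃ₗᵢ[ℂ] H'} {T : Copies d H →L[ℂ] H}
    {T' : Copies d H' →L[ℂ] H'} (hU : ∀ x, U (T x) = T' (ampl d (unitaryOp U) x))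
    {Γ : UnitBall d → K →L[ℂ] H} {Γ' : UnitBall d → K →L[ℂ] H'}
    (hΓ : ∀ z g, U (Γ z g) = Γ' z g) (x : H) :
    ‖(T'†) (U x)‖ ^ 2 + ‖((Γ' (origin d))†) (U x)‖ ^ 2 =
      ‖(T†) x‖ ^ 2 + ‖((Γ (origin d))†) x‖ ^ 2 := by
  rw [adjoint_apply_of_intertwine hU, norm_ampl_unitaryOp, adjoint_unitary_apply (hΓ _)]

theorem IsGleasonFor.transport {U : H ≃ₗᵢ[ℂ] H'} {T : Copies d H →L[ℂ] H}
    {T' : Copies d H' →L[ℂ] H'} (hU : ∀ x, U (T x) = T' (ampl d (unitaryOp U) x))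
    {Γ : UnitBall d → K →L[ℂ] H} {Γ' : UnitBall d → K →L[ℂ] H'}
    (hΓ : ∀ z g, U (Γ z g) = Γ' z g) (h : IsGleasonFor T Γ) : IsGleasonFor T' Γ' where
  recursion w g := by
    conv_lhs => rw [← hΓ, h.recursion, map_add, hU, ampl_colStar]
    rw [hΓ]
    exact congrArg (fun v => Γ' (origin d) g + T' (colStar H' w v)) (hΓ w g)
  norm_le y := by
    obtain ⟨x, rfl⟩ := U.surjective y
    rw [norm_sq_add_of_intertwine hU hΓ, U.norm_map]
    exact h.norm_le x

theorem IsExtremalFor.transport {U : H ≃ₗᵢ[ℂ] H'} {T : Copies d H →L[ℂ] H}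
    {T' : Copies d H' →L[ℂ] H'} (hU : ∀ x, U (T x) = T' (ampl d (unitaryOp U) x))
    {Γ : UnitBall d → K →L[ℂ] H} {Γ' : UnitBall d → K →L[ℂ] H'}
    (hΓ : ∀ z g, U (Γ z g) = Γ' z g) (h : IsExtremalFor T Γ) : IsExtremalFor T' Γ' where
  toIsGleasonFor := h.toIsGleasonFor.transport hU hΓ
  norm_eq y := by
    obtain ⟨x, rfl⟩ := U.surjective y
    rw [norm_sq_add_of_intertwine hU hΓ, U.norm_map]
    exact h.norm_eq x

theorem IsKernelFamily.transport {b : UnitBall d → J →L[ℂ] K} {U : H ≃ₗᵢ[ℂ] H'}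
    {Γ : UnitBall d → K →L[ℂ] H} {Γ' : UnitBall d → K →L[ℂ] H'}
    (hΓ : ∀ z g, U (Γ z g) = Γ' z g) (h : IsKernelFamily b Γ) : IsKernelFamily b Γ' where
  total y hy := by
    obtain ⟨x, rfl⟩ := U.surjective y
    rw [h.total x fun p => ?_, map_zero]
    rw [← U.inner_map_map, hΓ]
    exact hy p
  inner_eq z w g g' := by
    rw [← hΓ, ← hΓ, U.inner_map_map, h.inner_eq]

theorem IsGleasonFor.norm_le_one {T : Copies d H →L[ℂ] H} {Γ : UnitBall d → K →L[ℂ] H}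
    (h : IsGleasonFor T Γ) : ‖T‖ ≤ 1 := by
  rw [← ContinuousLinearMap.adjoint_adjoint T]
  refine norm_adjoint_le_one (ContinuousLinearMap.opNorm_le_bound _ zero_le_one fun x => ?_)
  rw [one_mul]
  refine abs_le_of_sq_le_sq' ?_ (norm_nonneg _) |>.2
  nlinarith [h.norm_le x, sq_nonneg ‖((Γ (origin d))†) x‖]

/-- The recursion is solved for `Γ(w)`. The whole family is thus determined by `T` and its value at
the origin. -/
theorem IsGleasonFor.eq_resolvent {T : Copies d H →L[ℂ] H} {Γ : UnitBall d → K →L[ℂ] H}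
    (h : IsGleasonFor T Γ) (w : UnitBall d) (g : K) :
    Γ w g = resolvent T w (Γ (origin d) g) := by
  rw [← resolvent_sub h.norm_le_one w (Γ w g)]
  congr 1
  rw [sub_eq_iff_eq_add]
  exact h.recursion w g

theorem IsExtremalFor.inner_adjoint {T : Copies d H →L[ℂ] H} {Γ : UnitBall d → K →L[ℂ] H}
    (h : IsExtremalFor T Γ) (x y : H) :
    inner ℂ (((Γ (origin d))†) x) (((Γ (origin d))†) y) =
      inner ℂ x y - inner ℂ ((T†) x) ((T†) y) :=
  inner_add_inner_of_adjoint_comp_self_eq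
    ((adjoint_comp_self_eq_iff _ _).mpr fun x => (add_comm _ _).trans (h.norm_eq x)) x y

theorem isTotal_adjoint_of_injective {A : K →L[ℂ] H} (hA : Function.Injective A) :
    IsTotal fun x => (A†) x := fun g hg => hA (by
  rw [map_zero]
  refine ext_inner_left ℂ fun x => ?_
  rw [← ContinuousLinearMap.adjoint_inner_left, hg, inner_zero_right])

/-- Two functions modelling the same row contraction coincide weakly. -/
theorem weaklyCoincide_of_isExtremalFor {T : Copies d H →L[ℂ] H}
    {b : UnitBall d → J →L[ℂ] K} {b' : UnitBall d → J' →L[ℂ] K'}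
    {Γ : UnitBall d → K →L[ℂ] H} {Γ' : UnitBall d → K' →L[ℂ] H}
    (h : IsExtremalFor T Γ) (h' : IsExtremalFor T Γ')
    (hb : IsKernelFamily b Γ) (hb' : IsKernelFamily b' Γ')
    (hi : Function.Injective (Γ (origin d))) (hi' : Function.Injective (Γ' (origin d))) :
    WeaklyCoincide b b' := by
  -- Extremality gives `Γ(0)Γ(0)^* = I - TT^* = Γ'(0)Γ'(0)^*`, so the vectors `Γ(0)^*x` and
  -- `Γ'(0)^*x` have the same Gram matrix. Injectivity makes both families total.
  obtain ⟨R, hR⟩ := (isTotal_adjoint_of_injective hi).exists_linearIsometryEquiv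
    (isTotal_adjoint_of_injective hi') fun x y => by rw [h.inner_adjoint, h'.inner_adjoint]
  have h0 : ∀ g, Γ (origin d) g = Γ' (origin d) (R g) := fun g => by
    refine ext_inner_right ℂ fun x => ?_
    rw [← ContinuousLinearMap.adjoint_inner_right, ← ContinuousLinearMap.adjoint_inner_right,
      ← hR, R.inner_map_map]
  have hw : ∀ w g, Γ w g = Γ' w (R g) := fun w g => by
    rw [h.eq_resolvent, h'.eq_resolvent, h0]
  -- Since `Γ(w) = Γ'(w)R`, the two kernel identities have equal left sides, and subtracting them
  -- compares `b(z)b(w)^*` with `b'(z)b'(w)^*`.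
  refine weaklyCoincide_iff.mpr ⟨R, fun z w g g' => ?_⟩
  have h1 := hb.inner_eq z w g g'
  have h2 := hb'.inner_eq z w (R g) (R g')
  rw [← hw, ← hw, R.inner_map_map] at h2
  linear_combination h2 - h1

/-- If `Γ(0)g = 0`, the kernel identity at the origin gives `‖b(0)^*g‖ = ‖g‖`. For `a = b(0)^*g`,
Cauchy–Schwarz then yields `‖a‖ ≤ ‖b(0)a‖`, against purity unless `g = 0`. -/
theorem IsKernelFamily.injective_of_isPure {b : UnitBall d → J →L[ℂ] K}
    {Γ : UnitBall d → K →L[ℂ] H} (h : IsKernelFamily b Γ) (hb : IsPure (b (origin d))) :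
    Function.Injective (Γ (origin d)) := by
  refine (injective_iff_map_eq_zero _).mpr fun g hg => ?_
  have h1 := h.inner_eq (origin d) (origin d) g g
  rw [hg, inner_zero_left, mul_zero, inner_self_eq_ofReal, inner_self_eq_ofReal,
    ← Complex.ofReal_sub, ← Complex.ofReal_zero, Complex.ofReal_inj] at h1
  by_contra hg0
  set a := ((b (origin d))†) g with ha
  have h2 : ‖g‖ = ‖a‖ := by
    refine (sq_eq_sq₀ (norm_nonneg _) (norm_nonneg _)).mp ?_
    linarith
  have ha0 : a ≠ 0 := fun h0 => hg0 (by rw [h0, norm_zero] at h2; exact norm_eq_zero.mp h2)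
  have h3 : ‖a‖ * ‖a‖ ≤ ‖g‖ * ‖b (origin d) a‖ := by
    rw [← @inner_self_eq_norm_mul_norm ℂ]
    conv_lhs => enter [2, 2]; rw [ha]
    rw [ContinuousLinearMap.adjoint_inner_left]
    exact (RCLike.re_le_norm _).trans (norm_inner_le_norm _ _)
  have h4 := hb a ha0
  have h5 : 0 < ‖a‖ := norm_pos_iff.mpr ha0
  rw [h2] at h3
  nlinarith

/-- A row contraction with an extremal family is `CCNC`. -/
theorem IsExtremalFor.isCCNC {b : UnitBall d → J →L[ℂ] K} {T : Copies d H →L[ℂ] H}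
    {Γ : UnitBall d → K →L[ℂ] H} (h : IsExtremalFor T Γ) (hb : IsKernelFamily b Γ) :
    IsCCNC T := by
  have hT := h.norm_le_one
  rw [IsCCNC, Submodule.topologicalClosure_eq_top_iff, Submodule.eq_bot_iff]
  intro x hx
  refine hb.total x fun p => ?_
  -- Orthogonality to `(I - Tz^*)⁻¹ ran D_{T^*}` means that `y = ((I - Tz^*)⁻¹)^*x` lies in `ker
  -- D_{T^*}`. By extremality `‖Γ(0)^*y‖² = ‖y‖² - ‖T^*y‖² = 0`, so `x` is orthogonal to `Γ(z)g`.
  have h1 : defect (T†) (((resolvent T p.1)†) x) = 0 := by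
    refine ext_inner_left ℂ fun y => ?_
    rw [← inner_defect_left, ContinuousLinearMap.adjoint_inner_right, inner_zero_right]
    exact hx _ (Submodule.mem_iSup_of_mem p.1 ⟨y, rfl⟩)
  rw [defect_eq_zero_iff (norm_adjoint_le_one hT), ContinuousLinearMap.adjoint_adjoint] at h1
  have h2 : ((Γ (origin d))†) (((resolvent T p.1)†) x) = 0 := by
    rw [← inner_self_eq_zero (𝕜 := ℂ), h.inner_adjoint, ContinuousLinearMap.adjoint_inner_right T,
      h1, sub_self]
  change inner ℂ (Γ p.1 p.2) x = 0
  rw [h.eq_resolvent, ← ContinuousLinearMap.adjoint_inner_right,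
    ← ContinuousLinearMap.adjoint_inner_right, h2, inner_zero_right]

end Family

/-! ### Gleason solutions in de Branges–Rovnyak spaces -/

section DeBranges

variable {d : ℕ}
variable {J : Type*} [NormedAddCommGroup J] [InnerProductSpace ℂ J] [CompleteSpace J]
variable {K : Type*} [NormedAddCommGroup K] [InnerProductSpace ℂ K] [CompleteSpace K]

/-- The kernel maps `k_w : K → ℋ(b)`. -/
def kernelMap (b : SchurClass d J K) (w : UnitBall d) : K →L[ℂ] DeBrangesRovnyak b :=
  RKHS.kerFun (DeBrangesRovnyak b) w

theorem kernelMap_inner (b : SchurClass d J K) (w : UnitBall d) (g : K) (f : DeBrangesRovnyak b) :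
    inner ℂ (kernelMap b w g) f = inner ℂ g (f w) := RKHS.kerFun_inner _ _ _

theorem inner_kernelMap (b : SchurClass d J K) (w : UnitBall d) (g : K) (f : DeBrangesRovnyak b) :
    inner ℂ f (kernelMap b w g) = inner ℂ (f w) g := RKHS.inner_kerFun _ _ _

theorem adjoint_kernelMap (b : SchurClass d J K) (w : UnitBall d) (f : DeBrangesRovnyak b) :
    ((kernelMap b w)†) f = f w := RKHS.adjoint_kerFun _ _

theorem isKernelFamily_kernelMap (b : SchurClass d J K) :
    IsKernelFamily b.toFun (kernelMap b) where
  total f hf := by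
    refine RKHS.ext fun z => ext_inner_left ℂ fun g => ?_
    rw [← kernelMap_inner, RKHS.coe_zero, Pi.zero_apply, inner_zero_right]
    exact hf (z, g)
  inner_eq z w g g' := by
    have h1 : inner ℂ (kernelMap b z g) (kernelMap b w g') = inner ℂ (dbrKernel b w z g) g' := by
      rw [← kernel_deBrangesRovnyak, RKHS.kernel_inner]; rfl
    have h2 : conj ((1 - inner ℂ z.1 w.1 : ℂ)⁻¹) = (1 - inner ℂ w.1 z.1)⁻¹ := by
      rw [map_inv₀, map_sub, map_one, inner_conj_symm]
    rw [h1, dbrKernel, Matrix.of_apply, smul_apply, inner_smul_left, h2,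
      mul_inv_cancel_left₀ (one_sub_inner_ne_zero z w)]
    rw [sub_apply, inner_sub_left, ContinuousLinearMap.comp_apply,
      ContinuousLinearMap.adjoint_inner_right]
    rfl

theorem kernelMap_origin (b : SchurClass d J K) (w : UnitBall d) (g : K) :
    kernelMap b w g (origin d) = g - b (origin d) (((b w)†) g) := by
  refine ext_inner_left ℂ fun g' => ?_
  have h := (isKernelFamily_kernelMap b).inner_eq (origin d) w g' g
  have h0 : inner ℂ w.1 (origin d).1 = 0 := inner_zero_right _
  rw [h0, sub_zero, one_mul, kernelMap_inner, ContinuousLinearMap.adjoint_inner_left] at h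
  rw [h, inner_sub_right]

theorem inner_colStar_kernelMap (b : SchurClass d J K) (z : UnitBall d) (g : K)
    (F : Copies d (DeBrangesRovnyak b)) :
    inner ℂ (colStar _ z (kernelMap b z g)) F = inner ℂ g (∑ j, z.1 j • (F j) z) := by
  rw [PiLp.inner_apply, inner_sum]
  refine Finset.sum_congr rfl fun j _ => ?_
  rw [colStar_apply, inner_smul_left, inner_smul_right, kernelMap_inner, RCLike.conj_conj]

theorem inner_colStar_kernelMap' (b : SchurClass d J K) (z : UnitBall d) (g : K)
    (F : Copies d (DeBrangesRovnyak b)) :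
    inner ℂ F (colStar _ z (kernelMap b z g)) = inner ℂ (∑ j, z.1 j • (F j) z) g := by
  rw [← inner_conj_symm, inner_colStar_kernelMap, inner_conj_symm]

/-- Paired with `g`, the reproducing property turns evaluation at `z` into an inner product with
`k_z g`. The two conditions are then adjoint to each other. -/
theorem recursion_iff (b : SchurClass d J K)
    (X : Copies d (DeBrangesRovnyak b) →L[ℂ] DeBrangesRovnyak b) :
    (∀ (f : DeBrangesRovnyak b) (z : UnitBall d),
      ∑ j, z.1 j • (((X†) f) j) z = f z - f (origin d)) ↔
    ∀ w g, kernelMap b w g = kernelMap b (origin d) g + X (colStar _ w (kernelMap b w g)) := by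
  have key : ∀ w g f, inner ℂ (X (colStar _ w (kernelMap b w g))) f =
      inner ℂ g (∑ j, w.1 j • (((X†) f) j) w) := fun w g f => by
    rw [← ContinuousLinearMap.adjoint_inner_right, inner_colStar_kernelMap]
  refine ⟨fun h w g => ext_inner_right ℂ fun f => ?_, fun h f z => ext_inner_left ℂ fun g => ?_⟩
  · rw [inner_add_left, key, h, kernelMap_inner, kernelMap_inner, inner_sub_right]
    ring
  · rw [← key, inner_sub_right, ← kernelMap_inner, ← kernelMap_inner]
    conv_rhs => rw [h z g, inner_add_left]
    ring

theorem isContractiveGleason_iff (b : SchurClass d J K)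
    (X : Copies d (DeBrangesRovnyak b) →L[ℂ] DeBrangesRovnyak b) :
    IsContractiveGleason b X ↔ IsGleasonFor X (kernelMap b) := by
  have h := adjoint_comp_self_le_iff (X†) ((kernelMap b (origin d))†)
  rw [ContinuousLinearMap.adjoint_adjoint, ContinuousLinearMap.adjoint_adjoint] at h
  exact ⟨fun hX => ⟨(recursion_iff b X).mp hX.1, h.mp hX.2⟩,
    fun hX => ⟨(recursion_iff b X).mpr hX.1, h.mpr hX.2⟩⟩

theorem isExtremal_iff (b : SchurClass d J K)
    (X : Copies d (DeBrangesRovnyak b) →L[ℂ] DeBrangesRovnyak b) :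
    IsContractiveGleason b X ∧ IsExtremal b X ↔ IsExtremalFor X (kernelMap b) := by
  have h := adjoint_comp_self_eq_iff (X†) ((kernelMap b (origin d))†)
  rw [ContinuousLinearMap.adjoint_adjoint, ContinuousLinearMap.adjoint_adjoint] at h
  rw [isContractiveGleason_iff]
  exact ⟨fun hX => ⟨hX.1, h.mp hX.2⟩, fun hX => ⟨hX.1, h.mpr hX.2⟩⟩

/-! ### Passing between Gleason solutions for `b` and for `ℋ(b)` -/

theorem isContractiveGleasonFor_iff (b : SchurClass d J K)
    (B : J →L[ℂ] Copies d (DeBrangesRovnyak b)) :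
    IsContractiveGleasonFor b B ↔
      (∀ (z : UnitBall d) (h : J), b z h - b (origin d) h = ∑ j, z.1 j • ((B h) j) z) ∧
      ∀ x, ‖B x‖ ^ 2 + ‖b (origin d) x‖ ^ 2 ≤ ‖x‖ ^ 2 :=
  and_congr_right fun _ => adjoint_comp_self_le_iff _ _

/-- An extremal Gleason solution for `b` gives an extremal Gleason solution for `ℋ(b)`. -/
theorem exists_isExtremalFor {b : SchurClass d J K} {B : J →L[ℂ] Copies d (DeBrangesRovnyak b)}
    (hB : ∀ (z : UnitBall d) (h : J), b z h - b (origin d) h = ∑ j, z.1 j • ((B h) j) z)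
    (hB' : B† ∘L B = 1 - (b (origin d))† ∘L b (origin d)) :
    ∃ X : Copies d (DeBrangesRovnyak b) →L[ℂ] DeBrangesRovnyak b,
      IsExtremalFor X (kernelMap b) := by
  have hfam := isKernelFamily_kernelMap b
  -- `A` is the adjoint of the desired `X`, prescribed on kernel vectors. The extremality of `B` and
  -- the kernel identity make the required Gram identity exact.
  obtain ⟨A, hA, hA'⟩ := hfam.total.exists_extension_of_inner
    (fun p => colStar _ p.1 (kernelMap b p.1 p.2) - B (((b p.1)†) p.2))
    ((kernelMap b (origin d))†) (by
      rintro ⟨z, g'⟩ ⟨w, g⟩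
      have h1 := hfam.inner_eq z w g' g
      have h2 := ContinuousLinearMap.adjoint_inner_left (b z) (((b w)†) g) g'
      have h3 := ContinuousLinearMap.adjoint_inner_right (b w) (((b z)†) g') g
      rw [inner_sub_left, inner_sub_right, inner_sub_right, inner_colStar_colStar]
      simp only [adjoint_kernelMap, kernelMap_origin, inner_sub_left, inner_sub_right,
        inner_colStar_kernelMap, inner_colStar_kernelMap', ← hB,
        inner_add_inner_of_adjoint_comp_self_eq hB']
      linear_combination h2 + h3 - h1)
  refine ⟨A†, ⟨fun w g => ?_, fun x => ?_⟩, fun x => ?_⟩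
  -- Kernel vectors are total, so the recursion may be tested against `k_z g'`, where the prescribed
  -- value of `A` applies.
  · rw [← sub_eq_iff_eq_add']
    refine sub_eq_zero.mp (hfam.total _ ?_)
    rintro ⟨z, g'⟩
    have h1 := hfam.inner_eq z w g' g
    have h2 := ContinuousLinearMap.adjoint_inner_right (b w) (((b z)†) g') g
    have h3 : A (kernelMap b z g') = colStar _ z (kernelMap b z g') - B (((b z)†) g') :=
      hA (z, g')
    rw [inner_sub_right, inner_sub_right, ContinuousLinearMap.adjoint_inner_right, h3,
      inner_sub_left, inner_colStar_colStar, inner_colStar_kernelMap', ← hB,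
      inner_kernelMap b (origin d), kernelMap_origin, inner_sub_left, inner_sub_left]
    linear_combination h1 - h2
  · rw [ContinuousLinearMap.adjoint_adjoint]; exact (hA' x).le
  · rw [ContinuousLinearMap.adjoint_adjoint]; exact hA' x

/-- Every contractive Gleason solution for `ℋ(b)` comes from one for `b`. -/
theorem exists_isContractiveGleasonFor {b : SchurClass d J K}
    {Y : Copies d (DeBrangesRovnyak b) →L[ℂ] DeBrangesRovnyak b}
    (hY : IsGleasonFor Y (kernelMap b)) :
    ∃ B, IsContractiveGleasonFor b B ∧ ∀ w g,
      (Y†) (kernelMap b w g) = colStar _ w (kernelMap b w g) - B (((b w)†) g) := by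
  have hfam := isKernelFamily_kernelMap b
  -- The recursion gives `Y z^*k_z g' = k_z g' - k_0 g'`, so mixed inner products with `Y^*k_w g`
  -- depend on `b` alone.
  have hl : ∀ z w g' g, inner ℂ (colStar _ z (kernelMap b z g')) ((Y†) (kernelMap b w g)) =
      inner ℂ (kernelMap b z g') (kernelMap b w g) -
        inner ℂ g' (g - b (origin d) (((b w)†) g)) := fun z w g' g => by
    rw [ContinuousLinearMap.adjoint_inner_right, ← kernelMap_origin, ← kernelMap_inner,
      ← inner_sub_left, eq_sub_of_add_eq' (hY.recursion z g').symm]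
  have hr : ∀ z w g' g, inner ℂ ((Y†) (kernelMap b z g')) (colStar _ w (kernelMap b w g)) =
      inner ℂ (kernelMap b z g') (kernelMap b w g) -
        inner ℂ (g' - b (origin d) (((b z)†) g')) g := fun z w g' g => by
    rw [← inner_conj_symm, hl, map_sub, inner_conj_symm, inner_conj_symm]
  -- The value that `B` must take at `b(w)^*g`.
  set v : UnitBall d × K → Copies d (DeBrangesRovnyak b) := fun p =>
    colStar _ p.1 (kernelMap b p.1 p.2) - (Y†) (kernelMap b p.1 p.2) with hv
  obtain ⟨A, hA, hA'⟩ := (isTotal_suppVec b.toFun).exists_extension v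
    (b (origin d) ∘L (supp b.toFun).subtypeL) (fun c => by
      -- For matching combinations `s`, `k`, `v` of `b(w)^*g`, `k_w g` and these values, `‖v‖² +
      -- ‖b(0)s‖² + ‖k‖² = ‖s‖² + ‖Y^*k‖² + ‖k_0^*k‖²`. Since the last two terms are at most `‖k‖²`,
      -- the bound needed for the extension follows.
      have h1 := norm_linearCombination_add₃ (suppVec b.toFun)
        (fun p => (Y†) (kernelMap b p.1 p.2))
        (fun p => ((kernelMap b (origin d))†) (kernelMap b p.1 p.2)) v
        (fun p => (b (origin d) ∘L (supp b.toFun).subtypeL) (suppVec b.toFun p))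
        (fun p => kernelMap b p.1 p.2) (by
          rintro ⟨z, g'⟩ ⟨w, g⟩
          have h1 := hfam.inner_eq z w g' g
          have e1 : inner ℂ (suppVec b.toFun (z, g')) (suppVec b.toFun (w, g)) =
            inner ℂ (((b z)†) g') (((b w)†) g) := rfl
          have e2 : ∀ p, (b (origin d) ∘L (supp b.toFun).subtypeL) (suppVec b.toFun p) =
            b (origin d) (((b p.1)†) p.2) := fun _ => rfl
          simp only [hv, e1, e2, adjoint_kernelMap, kernelMap_origin, inner_sub_left,
            inner_colStar_colStar, inner_sub_right, hl, hr]
          linear_combination -h1) c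
      have h2 := hY.norm_le
        (Finsupp.linearCombination ℂ (fun p : UnitBall d × K => kernelMap b p.1 p.2) c)
      rw [linearCombination_map (Y†), linearCombination_map ((kernelMap b (origin d))†),
        linearCombination_map] at h1
      linarith)
  -- So far the solution lives on the support. It is extended by zero, which is consistent because
  -- every `b(z)` vanishes on the orthogonal complement.
  set P := (supp b.toFun).orthogonalProjectionOnto with hP
  have hbP : ∀ z x, b z (P x : J) = b z x := fun z x => by
    refine ext_inner_left ℂ fun g => ?_
    rw [← ContinuousLinearMap.adjoint_inner_left, ← ContinuousLinearMap.adjoint_inner_left,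
      ← sub_eq_zero, ← inner_sub_right, ← neg_sub x, inner_neg_right,
      neg_eq_zero]
    exact (Submodule.sub_starProjection_mem_orthogonal x) _ (adjoint_mem_supp b.toFun z g)
  have hAz : ∀ z g' (s : supp b.toFun), inner ℂ (colStar _ z (kernelMap b z g')) (A s) =
      inner ℂ g' (b z s - b (origin d) s) := by
    intro z g' s
    have : (innerSL ℂ (colStar _ z (kernelMap b z g'))) ∘L A =
        (innerSL ℂ g') ∘L (b z - b (origin d)) ∘L (supp b.toFun).subtypeL := by
      refine (isTotal_suppVec b.toFun).ext ?_
      rintro ⟨w, g⟩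
      have h1 := hfam.inner_eq z w g' g
      have h2 := ContinuousLinearMap.adjoint_inner_left (b z) (((b w)†) g) g'
      change inner ℂ (colStar _ z (kernelMap b z g')) (A _) =
        inner ℂ g' (b z (((b w)†) g) - b (origin d) (((b w)†) g))
      rw [hA]
      simp only [hv, inner_sub_right, inner_colStar_colStar, hl]
      linear_combination h2 - h1
    exact DFunLike.congr_fun this s
  refine ⟨A ∘L P, (isContractiveGleasonFor_iff b _).mpr ⟨fun z x => ?_, fun x => ?_⟩,
    fun w g => ?_⟩
  · refine ext_inner_left ℂ fun g => ?_
    rw [← inner_colStar_kernelMap, ContinuousLinearMap.comp_apply, hAz, hbP, hbP]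
  · have h1 := hA' (P x)
    have h2 : ‖P x‖ ≤ ‖x‖ := Submodule.norm_orthogonalProjectionOnto_apply_le _ x
    have h3 : (b (origin d) ∘L (supp b.toFun).subtypeL) (P x) = b (origin d) x := hbP _ x
    rw [h3] at h1
    exact h1.trans (pow_le_pow_left₀ (norm_nonneg _) h2 2)
  · have h1 : P (((b w)†) g) = suppVec b.toFun (w, g) :=
      Submodule.orthogonalProjectionOnto_mem_subspace_eq_self (suppVec b.toFun (w, g))
    rw [ContinuousLinearMap.comp_apply, h1, hA]
    simp [hv]

/-- Both solutions come from the same Gleason solution for `b`, and its formula fixes their adjoints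
on all kernel vectors. -/
theorem IsQuasiExtreme.gleason_unique {b : SchurClass d J K} (hb : IsQuasiExtreme b)
    {Y Y' : Copies d (DeBrangesRovnyak b) →L[ℂ] DeBrangesRovnyak b}
    (hY : IsGleasonFor Y (kernelMap b)) (hY' : IsGleasonFor Y' (kernelMap b)) : Y = Y' := by
  obtain ⟨-, B₀, -, -, hB₀⟩ := hb
  obtain ⟨B, hB, h⟩ := exists_isContractiveGleasonFor hY
  obtain ⟨B', hB', h'⟩ := exists_isContractiveGleasonFor hY'
  rw [hB₀ B hB] at h
  rw [hB₀ B' hB'] at h'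
  refine ContinuousLinearMap.adjoint.injective
    ((isKernelFamily_kernelMap b).total.ext fun p => ?_)
  rw [h, h']

theorem IsQuasiExtreme.exists_isUniqueExtremalGleason {b : SchurClass d J K}
    (hb : IsQuasiExtreme b) : ∃ X, IsUniqueExtremalGleason b X := by
  obtain ⟨-, B, hB, hB', -⟩ := id hb
  obtain ⟨X, hX⟩ := exists_isExtremalFor hB.1 hB'
  obtain ⟨h1, h2⟩ := (isExtremal_iff b X).mpr hX
  exact ⟨X, h1, h2, fun Y hY =>
    hb.gleason_unique ((isContractiveGleason_iff b Y).mp hY) hX.toIsGleasonFor⟩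

/-- Uniqueness in `ℋ(b)` is carried to any realisation of its kernel. This makes it usable in the
space of another, weakly coinciding function. -/
theorem IsQuasiExtreme.eq_of_isGleasonFor {b : SchurClass d J K} (hb : IsQuasiExtreme b)
    {H : Type*} [NormedAddCommGroup H] [InnerProductSpace ℂ H] [CompleteSpace H]
    {Γ : UnitBall d → K →L[ℂ] H} (hΓ : IsKernelFamily b.toFun Γ)
    {T T' : Copies d H →L[ℂ] H} (hT : IsGleasonFor T Γ) (hT' : IsGleasonFor T' Γ) : T = T' := by
  obtain ⟨U, hU⟩ := hΓ.exists_unitary (isKernelFamily_kernelMap b)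
  exact conjRow_injective U (hb.gleason_unique (hT.transport (conjRow_ampl U T) hU)
    (hT'.transport (conjRow_ampl U T') hU))

/-- A row contraction modelled by `b` is unitarily equivalent to an extremal Gleason solution. -/
theorem IsExtremalFor.exists_unitarilyEquivalent {b : SchurClass d J K}
    {H : Type*} [NormedAddCommGroup H] [InnerProductSpace ℂ H] [CompleteSpace H]
    {Γ : UnitBall d → K →L[ℂ] H} (hΓ : IsKernelFamily b.toFun Γ)
    {T : Copies d H →L[ℂ] H} (hT : IsExtremalFor T Γ) :
    ∃ X, IsContractiveGleason b X ∧ IsExtremal b X ∧ UnitarilyEquivalent T X := by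
  obtain ⟨U, hU⟩ := hΓ.exists_unitary (isKernelFamily_kernelMap b)
  obtain ⟨h1, h2⟩ := (isExtremal_iff b _).mpr (hT.transport (conjRow_ampl U T) hU)
  exact ⟨conjRow U T, h1, h2, unitarilyEquivalent_conjRow U T⟩

end DeBranges

/-! ### The partial isometric part of a row contraction -/

section IsometricPart

variable {d : ℕ} {H : Type*} [NormedAddCommGroup H] [InnerProductSpace ℂ H] [CompleteSpace H]
variable {T : Copies d H →L[ℂ] H}

instance (T : Copies d H →L[ℂ] H) : CompleteSpace (LinearMap.ker (defect T).toLinearMap) :=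
  (defect T).isClosed_ker.completeSpace_coe

instance (V : Copies d H →L[ℂ] H) : CompleteSpace (LinearMap.ker V.toLinearMap) :=
  V.isClosed_ker.completeSpace_coe

/-- The projection onto the initial space of the partial isometric part. -/
def initialProj (T : Copies d H →L[ℂ] H) : Copies d H →L[ℂ] Copies d H :=
  (LinearMap.ker (defect T).toLinearMap).starProjection

theorem isometricPart_apply (T : Copies d H →L[ℂ] H) (x : Copies d H) :
    isometricPart T x = T (initialProj T x) := rfl

theorem inner_initialProj_left (T : Copies d H →L[ℂ] H) (x y : Copies d H) :
    inner ℂ (initialProj T x) y = inner ℂ x (initialProj T y) :=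
  Submodule.inner_starProjection_left_eq_right _ x y

theorem initialProj_initialProj (T : Copies d H →L[ℂ] H) (x : Copies d H) :
    initialProj T (initialProj T x) = initialProj T x :=
  Submodule.starProjection_eq_self_iff.mpr (Submodule.starProjection_apply_mem _ x)

theorem initialProj_eq_self (hT : ‖T‖ ≤ 1) {x : Copies d H} (hx : (T†) (T x) = x) :
    initialProj T x = x :=
  Submodule.starProjection_eq_self_iff.mpr ((defect_eq_zero_iff hT x).mpr hx)

theorem adjoint_apply_initialProj (hT : ‖T‖ ≤ 1) (x : Copies d H) :
    (T†) (T (initialProj T x)) = initialProj T x :=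
  (defect_eq_zero_iff hT _).mp (LinearMap.mem_ker.mp
    (Submodule.starProjection_apply_mem (LinearMap.ker (defect T).toLinearMap) x))

theorem adjoint_isometricPart (T : Copies d H →L[ℂ] H) (y : H) :
    ((isometricPart T)†) y = initialProj T ((T†) y) := by
  refine ext_inner_right ℂ fun x => ?_
  rw [ContinuousLinearMap.adjoint_inner_left, isometricPart_apply, inner_initialProj_left,
    ContinuousLinearMap.adjoint_inner_left]

/-- `T^*T` is the identity on `ker D_T`, so `V^*T = PT^*T = P`, where `P` is the initial projection.
-/
theorem adjoint_isometricPart_apply (hT : ‖T‖ ≤ 1) (x : Copies d H) :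
    ((isometricPart T)†) (T x) = initialProj T x := by
  refine ext_inner_right ℂ fun y => ?_
  rw [ContinuousLinearMap.adjoint_inner_left, isometricPart_apply,
    ← ContinuousLinearMap.adjoint_inner_right, adjoint_apply_initialProj hT,
    inner_initialProj_left]

theorem adjoint_isometricPart_self (hT : ‖T‖ ≤ 1) (x : Copies d H) :
    ((isometricPart T)†) (isometricPart T x) = initialProj T x := by
  rw [isometricPart_apply, adjoint_isometricPart_apply hT, initialProj_initialProj]

theorem initialProj_adjoint_isometricPart (T : Copies d H →L[ℂ] H) (y : H) :
    initialProj T (((isometricPart T)†) y) = ((isometricPart T)†) y := by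
  rw [adjoint_isometricPart, initialProj_initialProj]

theorem norm_isometricPart_le_one (hT : ‖T‖ ≤ 1) : ‖isometricPart T‖ ≤ 1 := by
  refine ContinuousLinearMap.opNorm_le_bound _ zero_le_one fun x => ?_
  rw [isometricPart_apply]
  refine (T.le_of_opNorm_le hT _).trans ?_
  gcongr
  exact Submodule.norm_starProjection_apply_le _ x

theorem apply_isometricPart_adjoint (hT : ‖T‖ ≤ 1) (y : H) :
    T ((T†) (isometricPart T (((isometricPart T)†) y))) =
      isometricPart T (((isometricPart T)†) y) := by
  rw [isometricPart_apply, adjoint_apply_initialProj hT]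

/-- The adjoint of `(V - z)V^*V` sends `x` to `V^*(x - Vz^*x)`. Thus `I - Vz^*` carries the
complement at `z` into `(ran V)^⊥`. -/
theorem mem_orthogonal_restrictedRange_iff (hT : ‖T‖ ≤ 1) (z : UnitBall d) (x : H) :
    x ∈ (restrictedRange (isometricPart T) z)ᗮ ↔
      ((isometricPart T)†) (x - isometricPart T (colStar H z x)) = 0 := by
  have key : ∀ y, inner ℂ (((isometricPart T - rowMul H z) ∘L (isometricPart T)† ∘L
      isometricPart T) y) x =
      inner ℂ y (((isometricPart T)†) (x - isometricPart T (colStar H z x))) := fun y => by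
    rw [ContinuousLinearMap.comp_apply, ContinuousLinearMap.comp_apply,
      adjoint_isometricPart_self hT, sub_apply, inner_sub_left, inner_rowMul_left,
      ← ContinuousLinearMap.adjoint_inner_right, ← inner_sub_right, inner_initialProj_left,
      map_sub, map_sub, initialProj_adjoint_isometricPart, adjoint_isometricPart_self hT]
  refine ⟨fun h => ?_, fun h => ?_⟩
  · refine ext_inner_left ℂ fun y => ?_
    rw [← key, inner_zero_right]
    exact h _ ⟨y, rfl⟩
  · rintro _ ⟨y, rfl⟩
    refine (key y).trans ?_
    rw [h, inner_zero_right]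

theorem mem_orthogonal_restrictedRange_origin (hT : ‖T‖ ≤ 1) (x : H) :
    x ∈ (restrictedRange (isometricPart T) (origin d))ᗮ ↔ ((isometricPart T)†) x = 0 := by
  rw [mem_orthogonal_restrictedRange_iff hT, colStar_origin, map_zero, sub_zero]

end IsometricPart

/-! ### Model triples -/

section Triples

variable {d : ℕ} {H : Type*} [NormedAddCommGroup H] [InnerProductSpace ℂ H] [CompleteSpace H]
variable {T : Copies d H →L[ℂ] H}
variable {Jinf : Type*} [NormedAddCommGroup Jinf] [InnerProductSpace ℂ Jinf] [CompleteSpace Jinf]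
variable {J₀ : Type*} [NormedAddCommGroup J₀] [InnerProductSpace ℂ J₀] [CompleteSpace J₀]

namespace ModelTriple

theorem resolvent_mem (hT : ‖T‖ ≤ 1) (z : UnitBall d)
    (x : ((restrictedRange (isometricPart T) (origin d))ᗮ : Submodule ℂ H)) :
    resolvent (isometricPart T) z x ∈ (restrictedRange (isometricPart T) z)ᗮ := by
  rw [mem_orthogonal_restrictedRange_iff hT, sub_resolvent (norm_isometricPart_le_one hT)]
  exact (mem_orthogonal_restrictedRange_origin hT _).mp x.2

theorem sub_mem (hT : ‖T‖ ≤ 1) (z : UnitBall d)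
    (x : ((restrictedRange (isometricPart T) z)ᗮ : Submodule ℂ H)) :
    (x : H) - isometricPart T (colStar H z x) ∈
      (restrictedRange (isometricPart T) (origin d))ᗮ :=
  (mem_orthogonal_restrictedRange_origin hT _).mpr
    ((mem_orthogonal_restrictedRange_iff hT z _).mp x.2)

/-- `(I - V z^*)⁻¹`, from `(ran V)^⊥` onto `(ran (V - z) V^* V)^⊥`. -/
def resolventEquiv (hT : ‖T‖ ≤ 1) (z : UnitBall d) :
    ((restrictedRange (isometricPart T) (origin d))ᗮ : Submodule ℂ H) ≃L[ℂ]
      ((restrictedRange (isometricPart T) z)ᗮ : Submodule ℂ H) :=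
  ContinuousLinearEquiv.equivOfInverse
    ((resolvent (isometricPart T) z ∘L Submodule.subtypeL _).codRestrict _ (resolvent_mem hT z))
    ((Submodule.subtypeL _ - isometricPart T ∘L colStar H z ∘L Submodule.subtypeL _).codRestrict _
      (sub_mem hT z))
    (fun x => Subtype.ext (sub_resolvent (norm_isometricPart_le_one hT) z (x : H)))
    (fun x => Subtype.ext (by exact resolvent_sub (norm_isometricPart_le_one hT) z (x : H)))

theorem coe_resolventEquiv (hT : ‖T‖ ≤ 1) (z : UnitBall d)
    (x : ((restrictedRange (isometricPart T) (origin d))ᗮ : Submodule ℂ H)) :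
    (resolventEquiv hT z x : H) = resolvent (isometricPart T) z x := rfl

/-- The model triple with `γ(z) = (I - V z^*)⁻¹` restricted to `(ran V)^⊥`. -/
def ofResolvent (hT : ‖T‖ ≤ 1) : ModelTriple (isometricPart T)
    (LinearMap.ker (isometricPart T).toLinearMap)
    ((restrictedRange (isometricPart T) (origin d))ᗮ : Submodule ℂ H) where
  atPoint := resolventEquiv hT
  atInfinity := LinearIsometryEquiv.refl ℂ _
  norm_atOrigin x := by
    rw [← Submodule.norm_coe, coe_resolventEquiv, resolvent_origin, Submodule.norm_coe]

variable (γ : ModelTriple (isometricPart T) Jinf J₀)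

theorem map_mem (z : UnitBall d) (g : J₀) :
    γ.map z g ∈ (restrictedRange (isometricPart T) z)ᗮ := (γ.atPoint z g).2

theorem exists_map_eq (z : UnitBall d) {x : H}
    (hx : x ∈ (restrictedRange (isometricPart T) z)ᗮ) : ∃ g, γ.map z g = x := by
  obtain ⟨g, hg⟩ := (γ.atPoint z).surjective ⟨x, hx⟩
  exact ⟨g, congrArg Subtype.val hg⟩

theorem map_eq_zero {z : UnitBall d} {g : J₀} (h : γ.map z g = 0) : g = 0 :=
  (γ.atPoint z).map_eq_zero_iff.mp (Subtype.ext h)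

theorem adjoint_map_map (g : J₀) : ((γ.map (origin d))†) (γ.map (origin d) g) = g := by
  have h := (adjoint_comp_self_eq_iff (γ.map (origin d)) (0 : J₀ →L[ℂ] J₀)).mpr fun x => by
    have : ‖γ.map (origin d) x‖ = ‖x‖ := γ.norm_atOrigin x
    simp [this]
  simpa using DFunLike.congr_fun h g

theorem inner_map_map (g g' : J₀) :
    inner ℂ (γ.map (origin d) g) (γ.map (origin d) g') = inner ℂ g g' := by
  rw [← ContinuousLinearMap.adjoint_inner_right, adjoint_map_map]

theorem adjoint_isometricPart_map (hT : ‖T‖ ≤ 1) (g : J₀) :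
    ((isometricPart T)†) (γ.map (origin d) g) = 0 :=
  (mem_orthogonal_restrictedRange_origin hT _).mp (γ.map_mem _ g)

theorem adjoint_map_isometricPart (hT : ‖T‖ ≤ 1) (x : Copies d H) :
    ((γ.map (origin d))†) (isometricPart T x) = 0 := by
  refine ext_inner_right ℂ fun g => ?_
  rw [ContinuousLinearMap.adjoint_inner_left, ← ContinuousLinearMap.adjoint_inner_right,
    adjoint_isometricPart_map γ hT, inner_zero_right, inner_zero_left]

theorem map_adjoint_map (hT : ‖T‖ ≤ 1) (x : H) :
    γ.map (origin d) (((γ.map (origin d))†) x) =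
      x - isometricPart T (((isometricPart T)†) x) := by
  obtain ⟨g, hg⟩ := γ.exists_map_eq (origin d)
    (x := x - isometricPart T (((isometricPart T)†) x)) (by
      rw [mem_orthogonal_restrictedRange_origin hT, map_sub, adjoint_isometricPart_self hT,
        initialProj_adjoint_isometricPart, sub_self])
  have : ((γ.map (origin d))†) x = g := by
    rw [← γ.adjoint_map_map g, hg, map_sub, adjoint_map_isometricPart γ hT, sub_zero]
  rw [this, hg]

theorem isometricPart_mapInf (h : Jinf) : isometricPart T (γ.mapInf h) = 0 :=
  (γ.atInfinity h).2

theorem initialProj_mapInf (hT : ‖T‖ ≤ 1) (h : Jinf) : initialProj T (γ.mapInf h) = 0 := by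
  rw [← adjoint_isometricPart_self hT, isometricPart_mapInf, map_zero]

theorem adjoint_mapInf_mapInf (h : Jinf) : ((γ.mapInf)†) (γ.mapInf h) = h := by
  have h1 := (adjoint_comp_self_eq_iff γ.mapInf (0 : Jinf →L[ℂ] Jinf)).mpr fun x => by
    have : ‖γ.mapInf x‖ = ‖x‖ := γ.atInfinity.norm_map x
    simp [this]
  simpa using DFunLike.congr_fun h1 h

theorem adjoint_mapInf_initialProj (hT : ‖T‖ ≤ 1) (x : Copies d H) :
    ((γ.mapInf)†) (initialProj T x) = 0 := by
  refine ext_inner_right ℂ fun g => ?_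
  rw [ContinuousLinearMap.adjoint_inner_left, inner_initialProj_left,
    initialProj_mapInf γ hT, inner_zero_right, inner_zero_left]

theorem mapInf_adjoint_mapInf (hT : ‖T‖ ≤ 1) (x : Copies d H) :
    γ.mapInf (((γ.mapInf)†) x) = x - initialProj T x := by
  obtain ⟨g, hg⟩ : ∃ g, γ.mapInf g = x - initialProj T x := by
    obtain ⟨g, hg⟩ := γ.atInfinity.surjective ⟨x - initialProj T x, by
      change isometricPart T _ = 0
      rw [map_sub, isometricPart_apply, isometricPart_apply, initialProj_initialProj, sub_self]⟩
    exact ⟨g, congrArg Subtype.val hg⟩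
  have : ((γ.mapInf)†) x = g := by
    rw [← γ.adjoint_mapInf_mapInf g, hg, map_sub, adjoint_mapInf_initialProj γ hT, sub_zero]
  rw [this, hg]

/-! #### The zero point -/

theorem zeroPoint_apply (h : Jinf) :
    γ.zeroPoint T h = -((γ.map (origin d))†) (T (γ.mapInf h)) := rfl

theorem adjoint_zeroPoint_apply (g : J₀) :
    ((γ.zeroPoint T)†) g = -((γ.mapInf)†) ((T†) (γ.map (origin d) g)) := by
  refine ext_inner_right ℂ fun h => ?_
  rw [ContinuousLinearMap.adjoint_inner_left, zeroPoint_apply, inner_neg_left, inner_neg_right,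
    ContinuousLinearMap.adjoint_inner_left, ContinuousLinearMap.adjoint_inner_left,
    ContinuousLinearMap.adjoint_inner_right]

/-- By `V^*T = P`, `T` maps `ker V` into `(ran V)^⊥`, so the projection `γ(0)γ(0)^*` hidden in
`γ(0)δ` acts as the identity. -/
theorem map_zeroPoint (hT : ‖T‖ ≤ 1) (h : Jinf) :
    γ.map (origin d) (γ.zeroPoint T h) = -T (γ.mapInf h) := by
  rw [zeroPoint_apply, map_neg, map_adjoint_map γ hT, adjoint_isometricPart_apply hT,
    initialProj_mapInf γ hT, map_zero, sub_zero]

theorem mapInf_adjoint_zeroPoint (hT : ‖T‖ ≤ 1) (g : J₀) :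
    γ.mapInf (((γ.zeroPoint T)†) g) = -(T†) (γ.map (origin d) g) := by
  rw [adjoint_zeroPoint_apply, map_neg, mapInf_adjoint_mapInf γ hT, ← adjoint_isometricPart,
    adjoint_isometricPart_map γ hT, sub_zero]

theorem adjoint_zeroPoint_adjoint_map (hT : ‖T‖ ≤ 1) (y : H) :
    ((γ.zeroPoint T)†) (((γ.map (origin d))†) y) = -((γ.mapInf)†) ((T†) y) := by
  refine ext_inner_right ℂ fun h => ?_
  rw [ContinuousLinearMap.adjoint_inner_left, ContinuousLinearMap.adjoint_inner_left,
    map_zeroPoint γ hT, inner_neg_left, inner_neg_right, ContinuousLinearMap.adjoint_inner_left,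
    ContinuousLinearMap.adjoint_inner_left]

theorem map_zeroPoint_adjoint (hT : ‖T‖ ≤ 1) (g : J₀) :
    γ.map (origin d) (γ.zeroPoint T (((γ.zeroPoint T)†) g)) =
      T ((T†) (γ.map (origin d) g)) := by
  rw [map_zeroPoint γ hT, mapInf_adjoint_zeroPoint γ hT, map_neg, neg_neg]

theorem norm_zeroPoint_le_one (hT : ‖T‖ ≤ 1) : ‖γ.zeroPoint T‖ ≤ 1 := by
  refine ContinuousLinearMap.opNorm_le_bound _ zero_le_one fun h => ?_
  have h1 : ‖γ.map (origin d) (γ.zeroPoint T h)‖ = ‖γ.zeroPoint T h‖ := γ.norm_atOrigin _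
  have h2 : ‖γ.mapInf h‖ = ‖h‖ := γ.atInfinity.norm_map h
  rw [← h1, map_zeroPoint γ hT, norm_neg, ← h2]
  exact T.le_of_opNorm_le hT _

theorem defect_adjoint_zeroPoint_sq (hT : ‖T‖ ≤ 1) (g : J₀) :
    defect ((γ.zeroPoint T)†) (defect ((γ.zeroPoint T)†) g) =
      g - γ.zeroPoint T (((γ.zeroPoint T)†) g) := by
  rw [defect_defect (norm_adjoint_le_one (γ.norm_zeroPoint_le_one hT)),
    ContinuousLinearMap.adjoint_adjoint]

/-- If `D_{δ^*}g = 0` and `x = γ(0)g`, then `TT^*x = x`, so `T^*x` lies in `ker D_T`. But its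
projection there is `V^*x = 0`, whence `x = 0`. This is why dividing by `D_{δ^*}` is unambiguous. -/
theorem defect_adjoint_zeroPoint_injective (hT : ‖T‖ ≤ 1) :
    Function.Injective (defect ((γ.zeroPoint T)†)) := by
  refine (injective_iff_map_eq_zero _).mpr fun g hg => ?_
  rw [defect_eq_zero_iff (norm_adjoint_le_one (γ.norm_zeroPoint_le_one hT)),
    ContinuousLinearMap.adjoint_adjoint] at hg
  have h1 := γ.map_zeroPoint_adjoint hT g
  rw [hg] at h1
  have h2 : (T†) (γ.map (origin d) g) = 0 := by
    rw [← initialProj_eq_self hT (congrArg (T†) h1.symm), ← adjoint_isometricPart,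
      adjoint_isometricPart_map γ hT]
  rw [h2, map_zero] at h1
  exact γ.map_eq_zero h1

theorem isTotal_defect_adjoint_zeroPoint (hT : ‖T‖ ≤ 1) :
    IsTotal fun g => defect ((γ.zeroPoint T)†) g := by
  have := isTotal_adjoint_of_injective (γ.defect_adjoint_zeroPoint_injective hT)
  rwa [adjoint_defect] at this

/-- This is `γ(∞)D_δ²γ(∞)^* = I - T^*T`: the right side vanishes on the initial space of `V`, and
`δ` represents `-T` on `ker V`. -/
theorem inner_defect_zeroPoint (hT : ‖T‖ ≤ 1) (p q : Copies d H) :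
    inner ℂ (defect (γ.zeroPoint T) (((γ.mapInf)†) p))
      (defect (γ.zeroPoint T) (((γ.mapInf)†) q)) = inner ℂ p q - inner ℂ (T p) (T q) := by
  have h1 : γ.mapInf (defect (γ.zeroPoint T) (defect (γ.zeroPoint T) (((γ.mapInf)†) q))) =
      q - (T†) (T q) := by
    rw [defect_defect (γ.norm_zeroPoint_le_one hT), map_sub, mapInf_adjoint_zeroPoint γ hT,
      map_zeroPoint γ hT, map_neg, neg_neg, mapInf_adjoint_mapInf γ hT, map_sub, map_sub,
      adjoint_apply_initialProj hT]
    abel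
  rw [inner_defect_left, ContinuousLinearMap.adjoint_inner_left, h1, inner_sub_right,
    ContinuousLinearMap.adjoint_inner_right]

/-! #### The characteristic function of the partial isometric part -/

theorem adjoint_denom (z : UnitBall d) (g : J₀) :
    ((γ.denom z)†) g = ((γ.map (origin d))†) (γ.map z g) := by
  refine ext_inner_right ℂ fun y => ?_
  rw [ContinuousLinearMap.adjoint_inner_left, denom, ContinuousLinearMap.comp_apply,
    ContinuousLinearMap.adjoint_inner_right, ContinuousLinearMap.adjoint_inner_left]

/-- The adjoint `γ(0)^*γ(z)` is bijective. If it kills `g`, then `x = γ(z)g` satisfies `x = VV^*x =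
Vz^*x`, so `x = 0`. It is onto because `(I - Vz^*)⁻¹γ(0)g` lies in the range of `γ(z)` and differs
from `γ(0)g` by an element of `ran V`. -/
theorem isUnit_denom (hT : ‖T‖ ≤ 1) (z : UnitBall d) : IsUnit (γ.denom z) := by
  have hV := norm_isometricPart_le_one hT
  suffices h : IsUnit ((γ.denom z)†) by
    have h' := h.star
    rwa [ContinuousLinearMap.star_eq_adjoint, ContinuousLinearMap.adjoint_adjoint] at h'
  rw [ContinuousLinearMap.isUnit_iff_bijective]
  refine ⟨(injective_iff_map_eq_zero _).mpr fun g hg => ?_, fun g => ?_⟩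
  · rw [adjoint_denom] at hg
    have h1 := γ.map_adjoint_map hT (γ.map z g)
    rw [hg, map_zero] at h1
    have h2 := (mem_orthogonal_restrictedRange_iff hT z _).mp (γ.map_mem z g)
    rw [map_sub, adjoint_isometricPart_self hT, sub_eq_zero] at h2
    rw [h2] at h1
    rw [eq_comm, sub_eq_zero, isometricPart_apply, initialProj_initialProj,
      ← isometricPart_apply] at h1
    exact γ.map_eq_zero (eq_zero_of_eq_comp_colStar hV h1)
  · obtain ⟨x, hx⟩ := γ.exists_map_eq z
      (x := resolvent (isometricPart T) z (γ.map (origin d) g)) (by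
        rw [mem_orthogonal_restrictedRange_iff hT, sub_resolvent hV,
          adjoint_isometricPart_map γ hT])
    refine ⟨x, ?_⟩
    have h1 := sub_resolvent hV z (γ.map (origin d) g)
    rw [← hx, sub_eq_iff_eq_add] at h1
    rw [adjoint_denom, h1, map_add, adjoint_map_map, adjoint_map_isometricPart γ hT, add_zero]

/-- Since `γ(z)^*` annihilates `(V - z)V^*u`, it takes the same value on `u - VV^*u = γ(0)γ(0)^*u`
and on `u - zV^*u = zγ(∞)h`. The choice of `γ(z)` away from the origin thus drops out of `b_V`. -/
theorem charFun_apply (hT : ‖T‖ ≤ 1) (z : UnitBall d) {h : Jinf} {u : H}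
    (hu : u - rowMul H z (((isometricPart T)†) u) = rowMul H z (γ.mapInf h)) :
    γ.charFun z h = ((γ.map (origin d))†) u := by
  have h1 : ∀ x, ((γ.map z)†) ((isometricPart T - rowMul H z)
      (((isometricPart T)†) (isometricPart T x))) = 0 := fun x => by
    refine ext_inner_right ℂ fun g => ?_
    rw [ContinuousLinearMap.adjoint_inner_left, inner_zero_left]
    exact γ.map_mem z g _ ⟨x, rfl⟩
  have h2 := h1 (((isometricPart T)†) u)
  rw [adjoint_isometricPart_self hT, initialProj_adjoint_isometricPart, sub_apply, map_sub,
    sub_eq_zero] at h2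
  have h3 : γ.denom z (((γ.map (origin d))†) u) = rowMul J₀ z (γ.numer z h) := by
    change ((γ.map z)†) (γ.map (origin d) (((γ.map (origin d))†) u)) =
      rowMul J₀ z (ampl d ((γ.map z)†) (γ.mapInf h))
    rw [rowMul_ampl, ← hu, map_adjoint_map γ hT, map_sub, map_sub, h2]
  change Ring.inverse (γ.denom z) (rowMul J₀ z (γ.numer z h)) = _
  rw [← h3]
  exact DFunLike.congr_fun (Ring.inverse_mul_cancel _ (γ.isUnit_denom hT z)) _

/-- `γ(0)^* (I - z T^*)⁻¹ z γ(∞)`. -/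
def transfer (γ : ModelTriple (isometricPart T) Jinf J₀) (z : UnitBall d) : Jinf →L[ℂ] J₀ :=
  (γ.map (origin d))† ∘L (resolvent T z)† ∘L rowMul H z ∘L γ.mapInf

/-- From `V^* - T^* = γ(∞)δ^*γ(0)^*`, the vector `y = (I - zT^*)⁻¹zγ(∞)h` also solves the
`V`-equation of `charFun_apply`, with `h` replaced by `h - δ^*γ(0)^*y`. -/
theorem charFun_sub (hT : ‖T‖ ≤ 1) (z : UnitBall d) (h : Jinf) :
    γ.charFun z (h - ((γ.zeroPoint T)†) (γ.transfer z h)) = γ.transfer z h := by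
  refine γ.charFun_apply hT z ?_
  set y := ((resolvent T z)†) (rowMul H z (γ.mapInf h)) with hy
  have h1 := adjoint_resolvent_sub hT z (rowMul H z (γ.mapInf h))
  rw [← hy] at h1
  have h2 : γ.mapInf (((γ.zeroPoint T)†) (γ.transfer z h)) =
      ((isometricPart T)†) y - (T†) y := by
    change γ.mapInf (((γ.zeroPoint T)†) (((γ.map (origin d))†) y)) = _
    rw [adjoint_zeroPoint_adjoint_map γ hT, map_neg, mapInf_adjoint_mapInf γ hT,
      adjoint_isometricPart, neg_sub]
  rw [map_sub, map_sub, h2, ← h1]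
  change y - _ = _
  rw [map_sub]
  abel

theorem isUnit_one_add (hT : ‖T‖ ≤ 1) (z : UnitBall d) :
    IsUnit (1 + (γ.zeroPoint T)† ∘L γ.charFun z) := by
  have hV := norm_isometricPart_le_one hT
  rw [ContinuousLinearMap.isUnit_iff_bijective]
  refine ⟨(injective_iff_map_eq_zero _).mpr fun k hk => ?_, fun h => ?_⟩
  · change k + ((γ.zeroPoint T)†) (γ.charFun z k) = 0 at hk
    set u := ((resolvent (isometricPart T) z)†) (rowMul H z (γ.mapInf k)) with hu
    have h1 := adjoint_resolvent_sub hV z (rowMul H z (γ.mapInf k))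
    rw [← hu] at h1
    rw [γ.charFun_apply hT z h1, adjoint_zeroPoint_adjoint_map γ hT, ← sub_eq_add_neg,
      sub_eq_zero] at hk
    -- The assumption reads `k = γ(∞)^*T^*u`, which converts the equation for `V` into `u = zT^*u`.
    have h2 : u = 0 := by
      refine eq_zero_of_eq_rowMul_adjoint hT (z := z) ?_
      rw [hk, mapInf_adjoint_mapInf γ hT, ← adjoint_isometricPart, map_sub] at h1
      exact sub_left_injective h1
    rw [hk, h2, map_zero, map_zero]
  · refine ⟨h - ((γ.zeroPoint T)†) (γ.transfer z h), ?_⟩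
    change (h - _) + ((γ.zeroPoint T)†) (γ.charFun z _) = h
    rw [charFun_sub γ hT, sub_add_cancel]

/-- Writing `t` for the transfer function, `charFun_sub` shows that `I - δ^*t` inverts `I + δ^*b_V`
and that `b_V(I - δ^*t) = t`. -/
theorem frostman_apply (hT : ‖T‖ ≤ 1) (z : UnitBall d) (h : Jinf) :
    (γ.charFun z + γ.zeroPoint T)
      (Ring.inverse (1 + (γ.zeroPoint T)† ∘L γ.charFun z) h) =
    γ.zeroPoint T h + (γ.transfer z h -
      γ.zeroPoint T (((γ.zeroPoint T)†) (γ.transfer z h))) := by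
  set k := h - ((γ.zeroPoint T)†) (γ.transfer z h) with hk
  have h1 : (1 + (γ.zeroPoint T)† ∘L γ.charFun z) k = h := by
    change k + ((γ.zeroPoint T)†) (γ.charFun z k) = h
    rw [hk, charFun_sub γ hT]
    abel
  have h2 : Ring.inverse (1 + (γ.zeroPoint T)† ∘L γ.charFun z) h = k := by
    conv_lhs => rw [← h1]
    exact DFunLike.congr_fun (Ring.inverse_mul_cancel _ (γ.isUnit_one_add hT z)) k
  rw [h2, add_apply, hk, charFun_sub γ hT, map_sub]
  abel

theorem isFrostmanShift_iff (hT : ‖T‖ ≤ 1) (b : UnitBall d → Jinf →L[ℂ] J₀) :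
    IsFrostmanShift (γ.zeroPoint T) γ.charFun b ↔ ∀ z h,
      defect ((γ.zeroPoint T)†) (b z h) = γ.zeroPoint T (defect (γ.zeroPoint T) h) +
        defect ((γ.zeroPoint T)†) (defect ((γ.zeroPoint T)†)
          (γ.transfer z (defect (γ.zeroPoint T) h))) := by
  simp only [defect_adjoint_zeroPoint_sq γ hT, ← frostman_apply γ hT]
  exact forall_congr' fun z => ContinuousLinearMap.ext_iff

/-- The division by `D_{δ^*}` succeeds because `δD_δ = D_{δ^*}δ`, giving `δ + D_{δ^*}tD_δ`. -/
theorem exists_isFrostmanShift (hT : ‖T‖ ≤ 1) :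
    ∃ b, IsFrostmanShift (γ.zeroPoint T) γ.charFun b := by
  refine ⟨fun z => γ.zeroPoint T + defect ((γ.zeroPoint T)†) ∘L γ.transfer z ∘L
    defect (γ.zeroPoint T), (γ.isFrostmanShift_iff hT _).mpr fun z h => ?_⟩
  have h1 := DFunLike.congr_fun (comp_defect (γ.norm_zeroPoint_le_one hT)) h
  simp only [ContinuousLinearMap.comp_apply] at h1
  rw [h1]
  simp

/-! ### The resolvent family of a row contraction and its kernel identity -/

/-- The family `(I - T w^*)⁻¹ γ(0) D_{δ^*}`. -/
def family (γ : ModelTriple (isometricPart T) Jinf J₀) (w : UnitBall d) : J₀ →L[ℂ] H :=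
  resolvent T w ∘L γ.map (origin d) ∘L defect ((γ.zeroPoint T)†)

theorem family_origin (g : J₀) :
    γ.family (origin d) g = γ.map (origin d) (defect ((γ.zeroPoint T)†) g) :=
  resolvent_origin T _

theorem adjoint_family (w : UnitBall d) (x : H) :
    ((γ.family w)†) x =
      defect ((γ.zeroPoint T)†) (((γ.map (origin d))†) (((resolvent T w)†) x)) := by
  refine ext_inner_right ℂ fun g => ?_
  rw [ContinuousLinearMap.adjoint_inner_left, inner_defect_left,
    ContinuousLinearMap.adjoint_inner_left, ContinuousLinearMap.adjoint_inner_left]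
  rfl

theorem injective_family_origin (hT : ‖T‖ ≤ 1) : Function.Injective (γ.family (origin d)) := by
  refine (injective_iff_map_eq_zero _).mpr fun g hg => ?_
  rw [family_origin] at hg
  exact (injective_iff_map_eq_zero _).mp (γ.defect_adjoint_zeroPoint_injective hT) g
    (γ.map_eq_zero hg)

/-- The counterpart of `inner_defect_zeroPoint` on `H`: `TT^*` is the identity on `ran V`, and
`γ(0)δδ^* = TT^*γ(0)`. It is exactly extremality of the family. -/
theorem map_defect_sq_adjoint_map (hT : ‖T‖ ≤ 1) (x : H) :
    γ.map (origin d) (defect ((γ.zeroPoint T)†) (defect ((γ.zeroPoint T)†)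
      (((γ.map (origin d))†) x))) = x - T ((T†) x) := by
  rw [defect_adjoint_zeroPoint_sq γ hT, map_sub, map_zeroPoint_adjoint γ hT,
    map_adjoint_map γ hT, map_sub, map_sub, apply_isometricPart_adjoint hT]
  abel

theorem isExtremalFor_family (hT : ‖T‖ ≤ 1) : IsExtremalFor T γ.family := by
  have h : (T†)† ∘L T† = 1 - ((γ.family (origin d))†)† ∘L (γ.family (origin d))† := by
    refine ContinuousLinearMap.ext fun x => ?_
    have h1 : ((resolvent T (origin d))†) x = x := by
      refine ext_inner_right ℂ fun y => ?_
      rw [ContinuousLinearMap.adjoint_inner_left, resolvent_origin]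
    rw [ContinuousLinearMap.adjoint_adjoint, ContinuousLinearMap.adjoint_adjoint]
    change T ((T†) x) = x - γ.family (origin d) (((γ.family (origin d))†) x)
    rw [adjoint_family, h1, family_origin, map_defect_sq_adjoint_map γ hT, sub_sub_cancel]
  have h2 := (adjoint_comp_self_eq_iff _ _).mp h
  refine ⟨⟨fun w g => ?_, fun x => (h2 x).le⟩, h2⟩
  rw [family_origin, ← sub_eq_iff_eq_add]
  exact sub_resolvent hT w _

theorem isTotal_family (hT : ‖T‖ ≤ 1) (hT' : IsCCNC T) :
    IsTotal fun p : UnitBall d × J₀ => γ.family p.1 p.2 := fun x hx => by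
  have h1 : ∀ w, defect (T†) (((resolvent T w)†) x) = 0 := fun w => by
    have h2 : ((γ.family w)†) x = 0 := by
      refine ext_inner_left ℂ fun g => ?_
      rw [ContinuousLinearMap.adjoint_inner_right, inner_zero_right]
      exact hx (w, g)
    rw [adjoint_family] at h2
    have h3 := γ.map_defect_sq_adjoint_map hT (((resolvent T w)†) x)
    rw [h2, map_zero, map_zero, eq_comm, sub_eq_zero] at h3
    rw [defect_eq_zero_iff (norm_adjoint_le_one hT), ContinuousLinearMap.adjoint_adjoint]
    exact h3.symm
  rw [IsCCNC, Submodule.topologicalClosure_eq_top_iff, Submodule.eq_bot_iff] at hT'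
  refine hT' x ?_
  rw [Submodule.mem_orthogonal]
  intro y hy
  induction hy using Submodule.iSup_induction' with
  | mem w y hy =>
    obtain ⟨v, rfl⟩ := hy
    change inner ℂ (resolvent T w (defect (T†) v)) x = 0
    rw [← ContinuousLinearMap.adjoint_inner_right, inner_defect_left, h1, inner_zero_right]
  | zero => simp
  | add y y' _ _ h h' => rw [inner_add_left, h, h', add_zero]

/-- The Frostman relation prescribes only `D_{δ^*}b(w)`, so its adjoint gives `b(w)^*` on the range
of `D_{δ^*}`, which is dense. -/
theorem adjoint_frostmanShift (hT : ‖T‖ ≤ 1) {b : UnitBall d → Jinf →L[ℂ] J₀}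
    (hb : IsFrostmanShift (γ.zeroPoint T) γ.charFun b) (w : UnitBall d) (g : J₀) :
    ((b w)†) (defect ((γ.zeroPoint T)†) g) = defect (γ.zeroPoint T) (((γ.mapInf)†)
      (colStar H w (γ.family w (defect ((γ.zeroPoint T)†) g)) -
        (T†) (γ.map (origin d) g))) := by
  rw [isFrostmanShift_iff γ hT] at hb
  have h1 : ((γ.mapInf)†) ((T†) (γ.map (origin d) g)) = -((γ.zeroPoint T)†) g := by
    rw [adjoint_zeroPoint_apply, neg_neg]
  refine ext_inner_right ℂ fun h => ?_
  rw [ContinuousLinearMap.adjoint_inner_left, inner_defect_left, hb, inner_add_right,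
    ← inner_defect_left, ← inner_defect_left, inner_defect_left _ (((γ.mapInf)†) _), map_sub, h1,
    sub_neg_eq_add, inner_add_left, ContinuousLinearMap.adjoint_inner_left (γ.zeroPoint T),
    ContinuousLinearMap.adjoint_inner_left γ.mapInf, ← inner_rowMul_right, add_comm]
  congr 1
  change inner ℂ _ (((γ.map (origin d))†) (((resolvent T w)†) _)) = _
  rw [ContinuousLinearMap.adjoint_inner_right, ContinuousLinearMap.adjoint_inner_right]
  rfl

/-- The kernel identity for characteristic functions. -/
theorem isKernelFamily_family (hT : ‖T‖ ≤ 1) (hT' : IsCCNC T) {b : UnitBall d → Jinf →L[ℂ] J₀}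
    (hb : IsFrostmanShift (γ.zeroPoint T) γ.charFun b) : IsKernelFamily b γ.family where
  total := γ.isTotal_family hT hT'
  inner_eq z w u' u := by
    -- The identity is first proved on the range of `D_{δ^*}`, where `inner_defect_zeroPoint`
    -- evaluates the `b` term.
    have core : ∀ g' g, (1 - inner ℂ w.1 z.1) *
        inner ℂ (γ.family z (defect ((γ.zeroPoint T)†) g'))
          (γ.family w (defect ((γ.zeroPoint T)†) g)) =
        inner ℂ (defect ((γ.zeroPoint T)†) g') (defect ((γ.zeroPoint T)†) g) -
        inner ℂ (((b z)†) (defect ((γ.zeroPoint T)†) g'))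
          (((b w)†) (defect ((γ.zeroPoint T)†) g)) := fun g' g => by
      have hx : ∀ v a, T (colStar H v (γ.family v (defect ((γ.zeroPoint T)†) a))) =
          γ.family v (defect ((γ.zeroPoint T)†) a) - (γ.map (origin d) a -
            γ.map (origin d) (γ.zeroPoint T (((γ.zeroPoint T)†) a))) := fun v a => by
        have h1 := (γ.isExtremalFor_family hT).recursion v (defect ((γ.zeroPoint T)†) a)
        rw [family_origin, defect_adjoint_zeroPoint_sq γ hT, map_sub] at h1
        rw [eq_sub_iff_add_eq']
        exact h1.symm
      rw [adjoint_frostmanShift γ hT hb, adjoint_frostmanShift γ hT hb,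
        inner_defect_zeroPoint γ hT, inner_defect_left, defect_adjoint_zeroPoint_sq γ hT]
      have e1 : inner ℂ (colStar H z (γ.family z (defect ((γ.zeroPoint T)†) g')))
          ((T†) (γ.map (origin d) g)) = _ := ContinuousLinearMap.adjoint_inner_right _ _ _
      have e2 : inner ℂ ((T†) (γ.map (origin d) g'))
          (colStar H w (γ.family w (defect ((γ.zeroPoint T)†) g))) = _ :=
        ContinuousLinearMap.adjoint_inner_left _ _ _
      have e3 : inner ℂ ((T†) (γ.map (origin d) g')) ((T†) (γ.map (origin d) g)) = _ :=
        ContinuousLinearMap.adjoint_inner_left _ _ _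
      have e4 : inner ℂ (γ.map (origin d) (γ.zeroPoint T (((γ.zeroPoint T)†) g')))
          (γ.map (origin d) g) = inner ℂ (γ.map (origin d) g')
          (γ.map (origin d) (γ.zeroPoint T (((γ.zeroPoint T)†) g))) := by
        rw [inner_map_map, inner_map_map, ← ContinuousLinearMap.adjoint_inner_right,
          ContinuousLinearMap.adjoint_inner_left]
      rw [hx] at e1 e2
      rw [← map_zeroPoint_adjoint γ hT] at e3
      -- The `TT^*γ(0)` contributions cancel, so `T` sends the argument of `γ(∞)^*` in
      -- `adjoint_frostmanShift` to `Γ(v)D_{δ^*}a - γ(0)a`.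
      have e5 : ∀ v a, T (colStar H v (γ.family v (defect ((γ.zeroPoint T)†) a)) -
          (T†) (γ.map (origin d) a)) =
          γ.family v (defect ((γ.zeroPoint T)†) a) - γ.map (origin d) a := fun v a => by
        rw [map_sub, hx, ← map_zeroPoint_adjoint γ hT]
        abel
      rw [e5, e5, inner_sub_left, inner_sub_right, inner_sub_right _ (colStar H w _) ((T†) _),
        inner_sub_right ((T†) _), e1, e2, e3,
        inner_colStar_colStar]
      simp only [inner_sub_left, inner_sub_right, e4]
      simp only [inner_map_map]
      ring
    -- Both sides are forms of bounded operators, so density of `ran D_{δ^*}` in each variable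
    -- extends the identity.
    set A : J₀ →L[ℂ] J₀ := (1 - inner ℂ w.1 z.1 : ℂ) • ((γ.family z)† ∘L γ.family w)
    set B : J₀ →L[ℂ] J₀ := 1 - b z ∘L (b w)†
    have hA : ∀ u' u, inner ℂ u' (A u) =
        (1 - inner ℂ w.1 z.1) * inner ℂ (γ.family z u') (γ.family w u) := fun u' u => by
      change inner ℂ u' ((1 - inner ℂ w.1 z.1 : ℂ) • ((γ.family z)†) (γ.family w u)) = _
      rw [inner_smul_right, ContinuousLinearMap.adjoint_inner_right]
    have hB : ∀ u' u, inner ℂ u' (B u) =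
        inner ℂ u' u - inner ℂ (((b z)†) u') (((b w)†) u) := fun u' u => by
      change inner ℂ u' (u - b z (((b w)†) u)) = _
      rw [inner_sub_right, ContinuousLinearMap.adjoint_inner_left]
    have htot := γ.isTotal_defect_adjoint_zeroPoint hT
    have hAB : A = B := htot.ext fun g => by
      refine sub_eq_zero.mp (htot _ fun g' => ?_)
      rw [inner_sub_right, hA, hB, core, sub_self]
    rw [← hA, hAB, hB]

end ModelTriple

end Triples

/-! ### Characteristic functions and Gleason solutions -/

section Characteristic

variable {d : ℕ} {H : Type u} [NormedAddCommGroup H] [InnerProductSpace ℂ H] [CompleteSpace H]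
variable {J : Type u} [NormedAddCommGroup J] [InnerProductSpace ℂ J] [CompleteSpace J]
variable {K : Type u} [NormedAddCommGroup K] [InnerProductSpace ℂ K] [CompleteSpace K]
variable {J' : Type u} [NormedAddCommGroup J'] [InnerProductSpace ℂ J'] [CompleteSpace J']
variable {K' : Type u} [NormedAddCommGroup K'] [InnerProductSpace ℂ K'] [CompleteSpace K']

/-- `T` is modelled by `b` through the family `Γ`. -/
structure IsModelledBy (T : Copies d H →L[ℂ] H) (b : UnitBall d → J →L[ℂ] K)
    (Γ : UnitBall d → K →L[ℂ] H) : Prop where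
  extremal : IsExtremalFor T Γ
  kernel : IsKernelFamily b Γ
  injective : Function.Injective (Γ (origin d))

theorem IsModelledBy.weaklyCoincide {T : Copies d H →L[ℂ] H} {b : UnitBall d → J →L[ℂ] K}
    {b' : UnitBall d → J' →L[ℂ] K'} {Γ : UnitBall d → K →L[ℂ] H} {Γ' : UnitBall d → K' →L[ℂ] H}
    (h : IsModelledBy T b Γ) (h' : IsModelledBy T b' Γ') : WeaklyCoincide b b' :=
  weaklyCoincide_of_isExtremalFor h.extremal h'.extremal h.kernel h'.kernel h.injective
    h'.injective

theorem IsModelledBy.congr {T : Copies d H →L[ℂ] H} {b : UnitBall d → J →L[ℂ] K}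
    {b' : UnitBall d → J' →L[ℂ] K'} {Γ : UnitBall d → K →L[ℂ] H}
    (h : IsModelledBy T b Γ) (hb : WeaklyCoincide b b') :
    ∃ Γ' : UnitBall d → K' →L[ℂ] H, IsModelledBy T b' Γ' := by
  obtain ⟨R, hR⟩ := weaklyCoincide_iff.mp hb
  exact ⟨_, h.extremal.comp_unitary R, h.kernel.of_weaklyCoincide hR,
    h.injective.comp R.symm.injective⟩

theorem IsModelledBy.transport {H' : Type u} [NormedAddCommGroup H'] [InnerProductSpace ℂ H']
    [CompleteSpace H'] {T : Copies d H →L[ℂ] H} {T' : Copies d H' →L[ℂ] H'}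
    {b : UnitBall d → J →L[ℂ] K} {Γ : UnitBall d → K →L[ℂ] H} (h : IsModelledBy T b Γ)
    (hT : UnitarilyEquivalent T T') : ∃ Γ' : UnitBall d → K →L[ℂ] H', IsModelledBy T' b Γ' := by
  obtain ⟨U, hU⟩ := hT
  exact ⟨fun w => unitaryOp U ∘L Γ w, h.extremal.transport hU fun _ _ => rfl,
    h.kernel.transport fun _ _ => rfl, U.injective.comp h.injective⟩

theorem IsCharacteristicFunction.isModelledBy {T : Copies d H →L[ℂ] H} {b : SchurClass d J K}
    (h : IsCharacteristicFunction T b) (hT : IsRowContraction T) (hT' : IsCCNC T) :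
    ∃ Γ, IsModelledBy T b.toFun Γ := by
  obtain ⟨Jinf, _, _, _, J₀, _, _, _, γ, bT, hγ, hb⟩ := h
  exact IsModelledBy.congr ⟨γ.isExtremalFor_family hT, γ.isKernelFamily_family hT hT' hγ,
    γ.injective_family_origin hT⟩ hb

/-- The Frostman shift built from the resolvent triple models `T` as well, and two functions
modelling one operator coincide weakly. -/
theorem IsModelledBy.isCharacteristicFunction {T : Copies d H →L[ℂ] H} {b : SchurClass d J K}
    {Γ : UnitBall d → K →L[ℂ] H} (h : IsModelledBy T b.toFun Γ) :
    IsCharacteristicFunction T b := by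
  have hT := h.extremal.norm_le_one
  have hT' := h.extremal.isCCNC h.kernel
  obtain ⟨bT, hbT⟩ := (ModelTriple.ofResolvent hT).exists_isFrostmanShift hT
  refine ⟨_, _, _, inferInstance, _, _, _, inferInstance, ModelTriple.ofResolvent hT, bT, hbT, ?_⟩
  exact IsModelledBy.weaklyCoincide
    ⟨ModelTriple.isExtremalFor_family _ hT, ModelTriple.isKernelFamily_family _ hT hT' hbT,
      ModelTriple.injective_family_origin _ hT⟩ h

theorem IsModelledBy.isQE [TopologicalSpace.SeparableSpace J] [TopologicalSpace.SeparableSpace K]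
    {T : Copies d H →L[ℂ] H} {b : SchurClass d J K} {Γ : UnitBall d → K →L[ℂ] H}
    (h : IsModelledBy T b.toFun Γ) (hb : IsQuasiExtreme b) : IsQE T :=
  ⟨h.extremal.norm_le_one, h.extremal.isCCNC h.kernel, J, _, _, inferInstance, inferInstance,
    K, _, _, inferInstance, inferInstance, b, hb, h.isCharacteristicFunction⟩

theorem IsQuasiExtreme.isModelledBy {b : SchurClass d J K} (hb : IsQuasiExtreme b)
    {X : Copies d (DeBrangesRovnyak b) →L[ℂ] DeBrangesRovnyak b}
    (hX : IsUniqueExtremalGleason b X) : IsModelledBy X b.toFun (kernelMap b) :=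
  ⟨(isExtremal_iff b X).mp ⟨hX.1, hX.2.1⟩, isKernelFamily_kernelMap b,
    (isKernelFamily_kernelMap b).injective_of_isPure (hb.1 _)⟩

/-- A modelled row contraction is the Gleason solution of any function coinciding weakly with a
quasi-extreme one. -/
theorem IsModelledBy.exists_isUniqueExtremalGleason {T : Copies d H →L[ℂ] H}
    {b : SchurClass d J K} {b' : SchurClass d J' K'} {Γ : UnitBall d → K →L[ℂ] H}
    {Γ' : UnitBall d → K' →L[ℂ] H} (h : IsModelledBy T b.toFun Γ)
    (h' : IsModelledBy T b'.toFun Γ') (hb' : IsQuasiExtreme b') :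
    ∃ X, IsUniqueExtremalGleason b X ∧ UnitarilyEquivalent T X := by
  obtain ⟨X, hX, hX', hTX⟩ := h.extremal.exists_unitarilyEquivalent h.kernel
  refine ⟨X, ⟨hX, hX', fun Y hY => ?_⟩, hTX⟩
  obtain ⟨R, hR⟩ := weaklyCoincide_iff.mp (h.weaklyCoincide h')
  -- Here `b` itself is not assumed quasi-extreme. Rotated by `R`, the kernel maps of `ℋ(b)` form a
  -- kernel family for `b'`, whose uniqueness identifies `Y` with `X`.
  exact hb'.eq_of_isGleasonFor ((isKernelFamily_kernelMap b).of_weaklyCoincide hR)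
    (((isContractiveGleason_iff b Y).mp hY).comp_unitary R)
    (((isContractiveGleason_iff b X).mp hX).comp_unitary R)

theorem IsQE.exists_isModelledBy {T : Copies d H →L[ℂ] H} (hT : IsQE T) :
    ∃ (J : Type u) (_ : NormedAddCommGroup J) (_ : InnerProductSpace ℂ J) (_ : CompleteSpace J)
      (_ : TopologicalSpace.SeparableSpace J)
      (K : Type u) (_ : NormedAddCommGroup K) (_ : InnerProductSpace ℂ K) (_ : CompleteSpace K)
      (_ : TopologicalSpace.SeparableSpace K)
      (b : SchurClass d J K) (Γ : UnitBall d → K →L[ℂ] H),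
      IsQuasiExtreme b ∧ IsModelledBy T b.toFun Γ := by
  obtain ⟨h1, h2, J, iJ, iJ', iJ'', sJ, K, iK, iK', iK'', sK, b, hb, hbT⟩ := hT
  obtain ⟨Γ, hΓ⟩ := hbT.isModelledBy h1 h2
  exact ⟨J, iJ, iJ', iJ'', sJ, K, iK, iK', iK'', sK, b, Γ, hb, hΓ⟩

end Characteristic

end RowModel

end

/-! ### Assembly of the theorem -/

theorem mainTheorem2 (d : ℕ) (hd : 0 < d) :
    -- a quasi-extreme `b` has a unique contractive Gleason solution `X^b`, and it is extremal
    (∀ (J : Type u) [NormedAddCommGroup J] [InnerProductSpace ℂ J] [CompleteSpace J]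
        [TopologicalSpace.SeparableSpace J]
        (K : Type u) [NormedAddCommGroup K] [InnerProductSpace ℂ K] [CompleteSpace K]
        [TopologicalSpace.SeparableSpace K]
        (b : SchurClass d J K), IsQuasiExtreme b → ∃ X, IsUniqueExtremalGleason b X) ∧
    -- `T` is QE iff it is unitarily equivalent to `X^b` for a quasi-extreme `b`
    (∀ (H : Type u) [NormedAddCommGroup H] [InnerProductSpace ℂ H] [CompleteSpace H]
        [TopologicalSpace.SeparableSpace H]
        (T : Copies d H →L[ℂ] H), IsRowContraction T →
        (IsQE T ↔
          ∃ (J : Type u) (_ : NormedAddCommGroup J) (_ : InnerProductSpace ℂ J)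
            (_ : CompleteSpace J) (_ : TopologicalSpace.SeparableSpace J)
            (K : Type u) (_ : NormedAddCommGroup K) (_ : InnerProductSpace ℂ K)
            (_ : CompleteSpace K) (_ : TopologicalSpace.SeparableSpace K)
            (b : SchurClass d J K), IsQuasiExtreme b ∧
              ∃ X, IsUniqueExtremalGleason b X ∧ UnitarilyEquivalent T X)) ∧
    -- a QE `T` is unitarily equivalent to `X^b` for each of its characteristic functions `b`
    (∀ (H : Type u) [NormedAddCommGroup H] [InnerProductSpace ℂ H] [CompleteSpace H]
        [TopologicalSpace.SeparableSpace H]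
        (T : Copies d H →L[ℂ] H), IsQE T →
        ∀ (J : Type u) [NormedAddCommGroup J] [InnerProductSpace ℂ J] [CompleteSpace J]
          [TopologicalSpace.SeparableSpace J]
          (K : Type u) [NormedAddCommGroup K] [InnerProductSpace ℂ K] [CompleteSpace K]
          [TopologicalSpace.SeparableSpace K]
          (b : SchurClass d J K), IsCharacteristicFunction T b →
            ∃ X, IsUniqueExtremalGleason b X ∧ UnitarilyEquivalent T X) ∧
    -- the characteristic function is a complete unitary invariant of QE row contractions
    (∀ (H₁ : Type u) [NormedAddCommGroup H₁] [InnerProductSpace ℂ H₁] [CompleteSpace H₁]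
        [TopologicalSpace.SeparableSpace H₁]
        (H₂ : Type u) [NormedAddCommGroup H₂] [InnerProductSpace ℂ H₂] [CompleteSpace H₂]
        [TopologicalSpace.SeparableSpace H₂]
        (T₁ : Copies d H₁ →L[ℂ] H₁) (T₂ : Copies d H₂ →L[ℂ] H₂), IsQE T₁ → IsQE T₂ →
        ∀ (J₁ : Type u) [NormedAddCommGroup J₁] [InnerProductSpace ℂ J₁] [CompleteSpace J₁]
          [TopologicalSpace.SeparableSpace J₁]
          (K₁ : Type u) [NormedAddCommGroup K₁] [InnerProductSpace ℂ K₁] [CompleteSpace K₁]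
          [TopologicalSpace.SeparableSpace K₁]
          (J₂ : Type u) [NormedAddCommGroup J₂] [InnerProductSpace ℂ J₂] [CompleteSpace J₂]
          [TopologicalSpace.SeparableSpace J₂]
          (K₂ : Type u) [NormedAddCommGroup K₂] [InnerProductSpace ℂ K₂] [CompleteSpace K₂]
          [TopologicalSpace.SeparableSpace K₂]
          (b₁ : SchurClass d J₁ K₁) (b₂ : SchurClass d J₂ K₂),
          IsCharacteristicFunction T₁ b₁ → IsCharacteristicFunction T₂ b₂ →
          (UnitarilyEquivalent T₁ T₂ ↔ WeaklyCoincide b₁.toFun b₂.toFun)) := by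
  refine ⟨?_, ?_, ?_, ?_⟩
  · intro J _ _ _ _ K _ _ _ _ b hb
    exact hb.exists_isUniqueExtremalGleason
  · intro H _ _ _ _ T hT
    constructor
    · intro h
      obtain ⟨J, iJ, iJ', iJ'', sJ, K, iK, iK', iK'', sK, b, Γ, hb, hΓ⟩ := h.exists_isModelledBy
      exact ⟨J, iJ, iJ', iJ'', sJ, K, iK, iK', iK'', sK, b, hb,
        hΓ.exists_isUniqueExtremalGleason hΓ hb⟩
    · rintro ⟨J, _, _, _, _, K, _, _, _, _, b, hb, X, hX, hTX⟩
      obtain ⟨Γ, hΓ⟩ := (hb.isModelledBy hX).transport hTX.symm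
      exact hΓ.isQE hb
  · intro H _ _ _ _ T hT J _ _ _ _ K _ _ _ _ b hbT
    -- The given characteristic function need not be the quasi-extreme one. A separate quasi-extreme
    -- witness `b'` supplies uniqueness.
    obtain ⟨J', _, _, _, _, K', _, _, _, _, b', Γ', hb', hΓ'⟩ := hT.exists_isModelledBy
    obtain ⟨Γ, hΓ⟩ := hbT.isModelledBy hT.1 hT.2.1
    exact hΓ.exists_isUniqueExtremalGleason hΓ' hb'
  · intro H₁ _ _ _ _ H₂ _ _ _ _ T₁ T₂ h₁ h₂ J₁ _ _ _ _ K₁ _ _ _ _ J₂ _ _ _ _ K₂ _ _ _ _ b₁ b₂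
      hb₁ hb₂
    obtain ⟨Γ₁, hΓ₁⟩ := hb₁.isModelledBy h₁.1 h₁.2.1
    obtain ⟨Γ₂, hΓ₂⟩ := hb₂.isModelledBy h₂.1 h₂.2.1
    constructor
    · intro h
      obtain ⟨Γ, hΓ⟩ := hΓ₁.transport h
      exact hΓ.weaklyCoincide hΓ₂
    · intro h
      -- Weak coincidence lets `b₂` model `T₁` too. Both operators are then unitarily equivalent to
      -- extremal Gleason solutions for `ℋ(b₂)`, of which there is only one.
      obtain ⟨Γ, hΓ⟩ := hΓ₁.congr h
      obtain ⟨J, _, _, _, _, K, _, _, _, _, b, Γ', hb, hΓ'⟩ := h₂.exists_isModelledBy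
      obtain ⟨X, hX, hTX⟩ := hΓ₂.exists_isUniqueExtremalGleason hΓ' hb
      obtain ⟨Y, hY, -, hTY⟩ := hΓ.extremal.exists_unitarilyEquivalent hΓ.kernel
      rw [hX.2.2 Y hY] at hTY
      exact hTY.trans hTX.symm
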